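/- **Conventions.** A *measurable groupoid* $\mathcal G$ is a groupoid which is a standard Borel space such that the unit space $\mathcal G^0$ and the set of composable pairs are Borel and the source $\mathfrak s$, range $\mathfrak r$, composition and inversion are Borel; it is *discrete* if all fibres $\mathfrak s^{-1}(x),\mathfrak r^{-1}(x)$ are countable. A *discrete pmp groupoid* $(\mathcal G,\mu)$ is a discrete measurable groupoid with a Borel probability measure $\mu$ on $\mathcal G^0$ such that $\int|\mathfrak s^{-1}(x)\cap B|\,d\mu(x)=\int|\mathfrak r^{-1}(x)\cap B|\,d\mu(x)=:\mu(B)$ for all Borel $B\subset\mathcal G$. A Borel groupoid morphism $\pi:\mathcal G\to\mathcal H$ between discrete pmp groupoids $(\mathcal G,\mu),(\mathcal H,\nu)$ is *pmp* if it pushes $\mu$ on $\mathcal G^0$ forward to $\nu$ on $\mathcal H^0$. It is a *class-bijective extension* if it is surjective and, for each $a\in\mathcal G^0$, restricts to bijections $\mathfrak s^{-1}(a)\to\mathfrak s^{-1}(\pi(a))$ and $\mathfrak r^{-1}(a)\to\mathfrak r^{-1}(\pi(a))$. A Borel subgroupoid (a Borel subset closed under composition and inversion) is *conull* if its complement in the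 groupoid (in the space of arrows) has measure $0$. Let $[\![\mathcal H]\!]$ be the set of Borel $f\subset\mathcal H$ on which $\mathfrak s$ and $\mathfrak r$ are injective, with product $fg=\{f'g':f'\in f,\ g'\in g\text{ composable}\}$; let $[\![d]\!]$ be this semigroup for the groupoid $\Delta_d=\{1,\dots,d\}^2$, where $\mathfrak s(i,j)=j$, $\mathfrak r(i,j)=i$, $(i,j)(j,k)=(i,k)$ and $\Delta_d^0$ is identified with $\{1,\dots,d\}$. Write $|E|_d=|E|/d$. For finite $F\subset[\![\mathcal H]\!]$ and $\delta>0$, a map $\sigma:[\![\mathcal H]\!]\to[\![d]\!]$ is *$(F,\delta)$-multiplicative* if $|\sigma(fg)\,\triangle\,\sigma(f)\sigma(g)|_d<\delta$ for $f,g\in F$, and *$(F,\delta)$-trace-preserving* if $\big||\sigma(f)\cap\Delta_d^0|_d-\nu(f\cap\mathcal H^0)\big|<\delta$ for $f\in F$. A *sofic approximation* to $(\mathcal H,\nu)$ is a family $\mathbb P=\{\mathbb P_j\}_{j\in J}$, indexed by a directed set $J$, of probability measures on $\mathrm{Map}([\![\mathcal H]\!],[\![d_j]\!])$ (with the $\sigma$-algebra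 generated by the cylinder sets) such that $d_j\to\infty$; for all $F,\delta$ the $\mathbb P_j$-probability that $\sigma$ is $(F,\delta)$-trace-preserving tends to $1$; for all $F,\delta$ there is $j$ such that for all $j'\ge j$, $\mathbb P_{j'}$-a.e. $\sigma$ is $(F,\delta)$-multiplicative; and, if $\nu(f\triangle f')=0$, then for every $j$, $\sigma(f)=\sigma(f')$ for $\mathbb P_j$-a.e. $\sigma$. A *bias* $\beta$ is $-$, $+$ or an ultrafilter on $J$ containing all tails $\{j':j'\ge j\}$, and $\lim_{j\to\beta}$ denotes the lower limit, the upper limit, or the ultralimit in $[-\infty,\infty]$, respectively. **Entropy.** Let $\pi:(\mathcal G,\mu)\to(\mathcal H,\nu)$ be a pmp class-bijective extension. For $f\in[\![\mathcal H]\!]$ and $A\subset\mathcal G^0$ put $f\cdot A=\mathfrak r(\pi^{-1}(f)\cap\mathfrak s^{-1}(A))$; for $\tau\in[\![d]\!]$ and $A\subset\Delta_d^0$ put $\tau\cdot A=\{i:(i,j)\in\tau\text{ for some }j\in A\}$. For a finite Borel partition $\mathcal P$ of $\mathcal G^0$, let $\Sigma(\mathcal P)$ be the $\sigma$-algebra it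 generates and $\mathcal P^F$ the coarsest partition such that every $f\cdot P$ ($f\in F$, $P\in\mathcal P$) is a union of its cells. For finite $F\subset[\![\mathcal H]\!]$ with $\mathcal H^0\in F$, let $\mathrm{Hom}(\pi,\sigma,\mathcal P,F,\delta)$ be the set of maps $\phi:\Sigma(\mathcal P^F)\to 2^{\Delta_d^0}$ preserving finite unions, finite intersections, $\emptyset$ and the whole space, such that $$\sum_{P\in\mathcal P}|\sigma(f)\cdot\phi(P)\,\triangle\,\phi(f\cdot P)|_d<\delta\quad\text{for all }f\in F,\qquad \sum_{P\in\mathcal P^F}\big||\phi(P)|_d-\mu(P)\big|<\delta .$$ For $\mathcal Q$ coarser than $\mathcal P$ (written $\mathcal Q\le\mathcal P$), let $|\mathrm{Hom}(\pi,\sigma,\mathcal P,F,\delta)|_{\mathcal Q}$ be the number of distinct restrictions of its elements to $\Sigma(\mathcal Q)$. For $p\in[1,\infty]$ and a bias $\beta$ set $$h_{\mathbb P,\mu}(\pi)=\sup_{\mathcal Q}\ \inf_{\mathcal P\ge\mathcal Q}\ \inf_{F\ni\mathcal H^0}\ \inf_{\delta>0}\ \lim_{j\to\beta}\frac1{d_j}\log\big\|\,|\mathrm{Hom}(\pi,\cdot,\mathcal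 P,F,\delta)|_{\mathcal Q}\big\|_{L^p(\mathbb P_j)}\in[-\infty,\infty],$$ over finite Borel partitions $\mathcal Q\le\mathcal P$ of $\mathcal G^0$ and finite $F\subset[\![\mathcal H]\!]$. **Theorem 11.1.** Let $(\mathcal G,\mu),(\mathcal H,\nu)$ be discrete pmp groupoids and $\pi:\mathcal G\to\mathcal H$ a pmp groupoid morphism. Suppose that for $i=1,2$ there are conull Borel subgroupoids $\mathcal G_i\subset\mathcal G$, $\mathcal H_i\subset\mathcal H$ such that $\pi$ restricts to a class-bijective extension $\pi_i:\mathcal G_i\to\mathcal H_i$. Let $\mathbb P$ be a sofic approximation to $(\mathcal H,\nu)$, let $p\in[1,\infty]$ and let $\beta$ be a bias. Then $$h_{\mathbb P,\mu}(\pi_1)=h_{\mathbb P,\mu}(\pi_2),$$ where the entropy of $\pi_i$ is computed with the restrictions of $\mu$ to $\mathcal G_i^0$ and of $\mathbb P$ to $[\![\mathcal H_i]\!]\subset[\![\mathcal H]\!]$. Hence all restrictions of $\pi$ to class-bijective extensions between conull Borel subgroupoids of $\mathcal G$ and $\mathcal H$ have one and the same entropy, so that the entropy of an extension which is class-bijective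 only almost everywhere is well defined. -/

import Mathlib

open MeasureTheory Filter Topology
open scoped ENNReal symmDiff

noncomputable section

namespace SoficEntropy

/-! ### Measurable groupoids -/

/-- A measurable groupoid with space of objects `X` and space of arrows `𝒢`, both standard Borel,
all of whose structure maps are Borel. `mul g h` is defined exactly when `s g = r h`. The map
`unit` is an injective Borel map of standard Borel spaces (`s ∘ unit = id`), hence identifies `X`
with a Borel subset of `𝒢`; likewise the set of composable pairs is Borel. -/
structure MeasurableGroupoid (X 𝒢 : Type*) [MeasurableSpace X] [MeasurableSpace 𝒢] where
  standardBorel_obj : StandardBorelSpace X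
  standardBorel_mor : StandardBorelSpace 𝒢
  /-- source -/
  s : 𝒢 → X
  /-- range -/
  r : 𝒢 → X
  /-- inclusion of the objects as identity arrows -/
  unit : X → 𝒢
  /-- inversion -/
  inv : 𝒢 → 𝒢
  /-- composition of composable pairs -/
  mul : ∀ g h : 𝒢, s g = r h → 𝒢
  s_unit : ∀ x, s (unit x) = x
  r_unit : ∀ x, r (unit x) = x
  s_mul : ∀ g h (e : s g = r h), s (mul g h e) = s h
  r_mul : ∀ g h (e : s g = r h), r (mul g h e) = r g
  mul_assoc : ∀ f g h (e : s f = r g) (e' : s g = r h),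
    mul (mul f g e) h ((s_mul f g e).trans e') = mul f (mul g h e') (e.trans (r_mul g h e').symm)
  unit_mul : ∀ g, mul (unit (r g)) g (s_unit _) = g
  mul_unit : ∀ g, mul g (unit (s g)) (r_unit _).symm = g
  s_inv : ∀ g, s (inv g) = r g
  r_inv : ∀ g, r (inv g) = s g
  inv_mul : ∀ g, mul (inv g) g (s_inv g) = unit (s g)
  mul_inv : ∀ g, mul g (inv g) (r_inv g).symm = unit (r g)
  measurable_s : Measurable s
  measurable_r : Measurable r
  measurable_unit : Measurable unit
  measurable_inv : Measurable inv
  measurable_mul : Measurable fun p : {p : 𝒢 × 𝒢 // s p.1 = r p.2} => mul p.1.1 p.1.2 p.2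

section Groupoid

variable {X 𝒢 : Type*} [MeasurableSpace X] [MeasurableSpace 𝒢] (G : MeasurableGroupoid X 𝒢)

/-- For a set `U` of arrows and a set `A` of objects, `U · A = r (U A)`: the set of ranges of the
arrows in `U` with source in `A`. -/
def MeasurableGroupoid.translate (U : Set 𝒢) (A : Set X) : Set X :=
  G.r '' {g | g ∈ U ∧ G.s g ∈ A}

/-- The value on `B` of the measure `μ_s` on arrows: `∫ |s⁻¹(x) ∩ B| dμ(x)`. -/
def MeasurableGroupoid.measS (μ : Measure X) (B : Set 𝒢) : ℝ≥0∞ :=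
  ∫⁻ x, ((G.s ⁻¹' {x} ∩ B).encard : ℝ≥0∞) ∂μ

/-- The value on `B` of the measure `μ_r` on arrows: `∫ |r⁻¹(x) ∩ B| dμ(x)`. -/
def MeasurableGroupoid.measR (μ : Measure X) (B : Set 𝒢) : ℝ≥0∞ :=
  ∫⁻ x, ((G.r ⁻¹' {x} ∩ B).encard : ℝ≥0∞) ∂μ

/-- `(G, μ)` is a discrete pmp groupoid: `μ` is a probability measure on the objects, all source
and range fibres are countable, and `μ_s = μ_r` on Borel sets of arrows. -/
structure MeasurableGroupoid.IsDiscretePMP (μ : Measure X) : Prop where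
  isProbabilityMeasure : IsProbabilityMeasure μ
  countable_s : ∀ x, (G.s ⁻¹' {x}).Countable
  countable_r : ∀ x, (G.r ⁻¹' {x}).Countable
  measS_eq_measR : ∀ B, MeasurableSet B → G.measS μ B = G.measR μ B

/-! ### Partial automorphisms -/

/-- The semigroup `⟦G⟧` of partial automorphisms: Borel sets of arrows on which source and range
are injective. (See `PartialAut.measurableEmbedding_s`: these restrictions are then automatically
Borel isomorphisms onto Borel images.) -/
@[ext]
structure PartialAut where
  carrier : Set 𝒢
  measurableSet : MeasurableSet carrier
  injOn_s : Set.InjOn G.s carrier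
  injOn_r : Set.InjOn G.r carrier

variable {G}

theorem PartialAut.measurableEmbedding_s (f : PartialAut G) :
    MeasurableEmbedding (fun g : f.carrier => G.s g) := by
  have := G.standardBorel_obj
  have := G.standardBorel_mor
  have := f.measurableSet.standardBorel
  exact (G.measurable_s.comp measurable_subtype_coe).measurableEmbedding
    f.injOn_s.injective

theorem PartialAut.measurableEmbedding_r (f : PartialAut G) :
    MeasurableEmbedding (fun g : f.carrier => G.r g) := by
  have := G.standardBorel_obj
  have := G.standardBorel_mor
  have := f.measurableSet.standardBorel
  exact (G.measurable_r.comp measurable_subtype_coe).measurableEmbedding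
    f.injOn_r.injective

variable (G) in
theorem MeasurableGroupoid.unit_injective : Function.Injective G.unit := fun x y h => by
  rw [← G.s_unit x, ← G.s_unit y, h]

variable (G) in
theorem MeasurableGroupoid.measurableSet_composable :
    MeasurableSet {p : 𝒢 × 𝒢 | G.s p.1 = G.r p.2} := by
  have := G.standardBorel_obj
  exact measurableSet_eq_fun (G.measurable_s.comp measurable_fst)
    (G.measurable_r.comp measurable_snd)

variable (G) in
/-- The set of all units, as a partial automorphism. -/
def PartialAut.one : PartialAut G where
  carrier := Set.range G.unit
  measurableSet := by
    have := G.standardBorel_obj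
    have := G.standardBorel_mor
    exact (G.measurable_unit.measurableEmbedding G.unit_injective).measurableSet_range
  injOn_s := by
    rintro _ ⟨x, rfl⟩ _ ⟨y, rfl⟩ h
    rw [G.s_unit, G.s_unit] at h
    rw [h]
  injOn_r := by
    rintro _ ⟨x, rfl⟩ _ ⟨y, rfl⟩ h
    rw [G.r_unit, G.r_unit] at h
    rw [h]

/-- The product `f g = {f' g' : f' ∈ f, g' ∈ g composable}`. -/
def PartialAut.mul (f g : PartialAut G) : PartialAut G where
  carrier := {k | ∃ a ∈ f.carrier, ∃ b ∈ g.carrier, ∃ e : G.s a = G.r b, G.mul a b e = k}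
  measurableSet := by
    have := G.standardBorel_obj
    have := G.standardBorel_mor
    have := G.measurableSet_composable.standardBorel
    have key : MeasurableSet ((fun p : {p : 𝒢 × 𝒢 // G.s p.1 = G.r p.2} =>
        G.mul p.1.1 p.1.2 p.2) '' {p | p.1.1 ∈ f.carrier ∧ p.1.2 ∈ g.carrier}) := by
      have hm : MeasurableSet {p : {p : 𝒢 × 𝒢 // G.s p.1 = G.r p.2} |
          p.1.1 ∈ f.carrier ∧ p.1.2 ∈ g.carrier} :=
        ((measurable_fst.comp measurable_subtype_coe) f.measurableSet).inter
          ((measurable_snd.comp measurable_subtype_coe) g.measurableSet)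
      have : StandardBorelSpace {p : 𝒢 × 𝒢 // G.s p.1 = G.r p.2} :=
        G.measurableSet_composable.standardBorel
      refine hm.image_of_measurable_injOn G.measurable_mul ?_
      rintro ⟨⟨a, b⟩, e⟩ ⟨ha, hb⟩ ⟨⟨a', b'⟩, e'⟩ ⟨ha', hb'⟩ h
      have hbb : b = b' := g.injOn_s hb hb' (by
        rw [← G.s_mul a b e, ← G.s_mul a' b' e']; exact congrArg G.s h)
      have haa : a = a' := f.injOn_r ha ha' (by
        rw [← G.r_mul a b e, ← G.r_mul a' b' e']; exact congrArg G.r h)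
      subst hbb haa
      rfl
    convert key using 1
    ext k
    constructor
    · rintro ⟨a, ha, b, hb, e, rfl⟩
      exact ⟨⟨(a, b), e⟩, ⟨ha, hb⟩, rfl⟩
    · rintro ⟨⟨⟨a, b⟩, e⟩, ⟨ha, hb⟩, rfl⟩
      exact ⟨a, ha, b, hb, e, rfl⟩
  injOn_s := by
    rintro _ ⟨a, ha, b, hb, e, rfl⟩ _ ⟨a', ha', b', hb', e', rfl⟩ h
    rw [G.s_mul, G.s_mul] at h
    obtain rfl := g.injOn_s hb hb' h
    obtain rfl := f.injOn_s ha ha' (e.trans e'.symm)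
    rfl
  injOn_r := by
    rintro _ ⟨a, ha, b, hb, e, rfl⟩ _ ⟨a', ha', b', hb', e', rfl⟩ h
    rw [G.r_mul, G.r_mul] at h
    obtain rfl := f.injOn_r ha ha' h
    obtain rfl := g.injOn_r hb hb' (e.symm.trans e')
    rfl

/-- The trace `μ (f ∩ G⁰)`. -/
def PartialAut.trace (f : PartialAut G) (μ : Measure X) : ℝ :=
  μ.real {x | G.unit x ∈ f.carrier}

end Groupoid

/-! ### The full groupoid on `d` points and sofic approximations -/

/-- The full groupoid `Δ_d`: arrows are pairs `(i, j)` with range `i` and source `j`, and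
`(i, j) (j, k) = (i, k)`. -/
def fullGroupoid (d : ℕ) : MeasurableGroupoid (Fin d) (Fin d × Fin d) where
  standardBorel_obj := inferInstance
  standardBorel_mor := inferInstance
  s := Prod.snd
  r := Prod.fst
  unit i := (i, i)
  inv p := (p.2, p.1)
  mul p q _ := (p.1, q.2)
  s_unit _ := rfl
  r_unit _ := rfl
  s_mul _ _ _ := rfl
  r_mul _ _ _ := rfl
  mul_assoc _ _ _ _ _ := rfl
  unit_mul _ := rfl
  mul_unit _ := rfl
  s_inv _ := rfl
  r_inv _ := rfl
  inv_mul _ := rfl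
  mul_inv _ := rfl
  measurable_s := measurable_snd
  measurable_r := measurable_fst
  measurable_unit := measurable_from_top
  measurable_inv := measurable_snd.prodMk measurable_fst
  measurable_mul := (measurable_fst.comp (measurable_fst.comp measurable_subtype_coe)).prodMk
    (measurable_snd.comp (measurable_snd.comp measurable_subtype_coe))

/-- `⟦d⟧`, the partial automorphisms of `Δ_d`. -/
abbrev FinPartialAut (d : ℕ) := PartialAut (fullGroupoid d)

/-- `⟦d⟧` is a finite set with its discrete σ-algebra. -/
instance (d : ℕ) : MeasurableSpace (FinPartialAut d) := ⊤

section Sofic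

variable {Y ℋ : Type*} [MeasurableSpace Y] [MeasurableSpace ℋ] (H : MeasurableGroupoid Y ℋ)

/-- `Map(⟦H⟧, ⟦d⟧)`. It carries the product σ-algebra, i.e. the one generated by the cylinder sets
`{σ' | ∀ f ∈ F, σ' f = σ f}` with `F` finite. -/
abbrev SoficMap (d : ℕ) := PartialAut H → FinPartialAut d

variable {H}

/-- `(F, δ)`-multiplicative maps. -/
def IsMultiplicative {d : ℕ} (σ : SoficMap H d) (F : Finset (PartialAut H)) (δ : ℝ) : Prop :=
  ∀ f ∈ F, ∀ g ∈ F,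
    (((σ (f.mul g)).carrier ∆ ((σ f).mul (σ g)).carrier).ncard : ℝ) / d < δ

/-- `(F, δ)`-trace-preserving maps. -/
def IsTracePreserving {d : ℕ} (ν : Measure Y) (σ : SoficMap H d) (F : Finset (PartialAut H))
    (δ : ℝ) : Prop :=
  ∀ f ∈ F,
    |({i | (fullGroupoid d).unit i ∈ (σ f).carrier}.ncard : ℝ) / d - f.trace ν| < δ

variable (H) in
/-- The family `P j` of probability measures on `Map(⟦H⟧, ⟦d j⟧)`, indexed by a directed set, is a
sofic approximation to `(H, ν)`. -/
structure IsSoficApproximation (ν : Measure Y) {J : Type*} [Preorder J] (d : J → ℕ)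
    (P : ∀ j, Measure (SoficMap H (d j))) : Prop where
  isProbabilityMeasure : ∀ j, IsProbabilityMeasure (P j)
  trace : ∀ (F : Finset (PartialAut H)) (δ : ℝ), 0 < δ →
    Tendsto (fun j => P j {σ | IsTracePreserving ν σ F δ}) atTop (𝓝 1)
  multiplicative : ∀ (F : Finset (PartialAut H)) (δ : ℝ), 0 < δ →
    ∃ j, ∀ j', j ≤ j' → ∀ᵐ σ ∂(P j'), IsMultiplicative σ F δ
  tendsto_d : Tendsto d atTop atTop
  null : ∀ f f' : PartialAut H, H.measS ν (f.carrier ∆ f'.carrier) = 0 →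
    ∀ j, ∀ᵐ σ ∂(P j), σ f = σ f'

end Sofic

/-! ### Morphisms and class-bijective extensions -/

section Morphism

variable {X 𝒢 Y ℋ : Type*} [MeasurableSpace X] [MeasurableSpace 𝒢] [MeasurableSpace Y]
  [MeasurableSpace ℋ]

/-- A Borel groupoid morphism; `obj` is the map on objects, determined by the map `mor` on
arrows. -/
structure GroupoidMorphism (G : MeasurableGroupoid X 𝒢) (H : MeasurableGroupoid Y ℋ) where
  obj : X → Y
  mor : 𝒢 → ℋ
  map_s : ∀ g, H.s (mor g) = obj (G.s g)
  map_r : ∀ g, H.r (mor g) = obj (G.r g)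
  map_unit : ∀ x, mor (G.unit x) = H.unit (obj x)
  map_inv : ∀ g, mor (G.inv g) = H.inv (mor g)
  map_mul : ∀ g h (e : G.s g = G.r h),
    mor (G.mul g h e) = H.mul (mor g) (mor h) (by rw [map_s, map_r, e])
  measurable_obj : Measurable obj
  measurable_mor : Measurable mor

variable {G : MeasurableGroupoid X 𝒢} {H : MeasurableGroupoid Y ℋ}

/-- A class-bijective extension: `π` maps each source (range) fibre bijectively onto the source
(range) fibre over the image object, and is surjective. -/
structure GroupoidMorphism.IsClassBijectiveExtension (π : GroupoidMorphism G H) : Prop where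
  bijOn_s : ∀ x, Set.BijOn π.mor (G.s ⁻¹' {x}) (H.s ⁻¹' {π.obj x})
  bijOn_r : ∀ x, Set.BijOn π.mor (G.r ⁻¹' {x}) (H.r ⁻¹' {π.obj x})
  surjective : Function.Surjective π.mor

/-- `π : (G, μ) → (H, ν)` is a probability-measure-preserving morphism of discrete pmp
groupoids: the probability measure `μ` on the objects of `G` is pushed to the probability
measure `ν` on the objects of `H`. -/
structure GroupoidMorphism.IsPMP (π : GroupoidMorphism G H) (μ : Measure X) (ν : Measure Y) :
    Prop where
  source : G.IsDiscretePMP μ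
  target : H.IsDiscretePMP ν
  map_eq : μ.map π.obj = ν

end Morphism

/-! ### Borel subgroupoids -/

section Subgroupoid

variable {X 𝒢 Y ℋ : Type*} [MeasurableSpace X] [MeasurableSpace 𝒢] [MeasurableSpace Y]
  [MeasurableSpace ℋ]

/-- A Borel subgroupoid: a Borel set of arrows closed under composition and inversion. -/
structure BorelSubgroupoid (G : MeasurableGroupoid X 𝒢) where
  carrier : Set 𝒢
  measurableSet : MeasurableSet carrier
  mul_mem : ∀ g h (e : G.s g = G.r h), g ∈ carrier → h ∈ carrier → G.mul g h e ∈ carrier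
  inv_mem : ∀ g, g ∈ carrier → G.inv g ∈ carrier

namespace BorelSubgroupoid

variable {G : MeasurableGroupoid X 𝒢} {H : MeasurableGroupoid Y ℋ} (K : BorelSubgroupoid G)

/-- The objects of a subgroupoid: those whose identity arrow lies in it. -/
def obj : Set X := G.unit ⁻¹' K.carrier

theorem measurableSet_obj : MeasurableSet K.obj := G.measurable_unit K.measurableSet

theorem s_mem {g : 𝒢} (hg : g ∈ K.carrier) : G.s g ∈ K.obj := by
  have := K.mul_mem _ _ (G.s_inv g) (K.inv_mem g hg) hg
  rwa [G.inv_mul] at this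

theorem r_mem {g : 𝒢} (hg : g ∈ K.carrier) : G.r g ∈ K.obj := by
  have := K.mul_mem _ _ (G.r_inv g).symm hg (K.inv_mem g hg)
  rwa [G.mul_inv] at this

/-- `K` is conull in `(G, μ)`: the measure `μ_s` on arrows gives its complement measure `0`. -/
def IsConull (μ : Measure X) : Prop := G.measS μ K.carrierᶜ = 0

/-- A Borel subgroupoid is itself a measurable groupoid. -/
def toGroupoid : MeasurableGroupoid K.obj K.carrier where
  standardBorel_obj := have := G.standardBorel_obj; K.measurableSet_obj.standardBorel
  standardBorel_mor := have := G.standardBorel_mor; K.measurableSet.standardBorel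
  s g := ⟨G.s g, K.s_mem g.2⟩
  r g := ⟨G.r g, K.r_mem g.2⟩
  unit x := ⟨G.unit x, x.2⟩
  inv g := ⟨G.inv g, K.inv_mem g g.2⟩
  mul g h e := ⟨G.mul g h (congrArg Subtype.val e), K.mul_mem _ _ _ g.2 h.2⟩
  s_unit x := Subtype.ext (G.s_unit x)
  r_unit x := Subtype.ext (G.r_unit x)
  s_mul _ _ _ := Subtype.ext (G.s_mul _ _ _)
  r_mul _ _ _ := Subtype.ext (G.r_mul _ _ _)
  mul_assoc _ _ _ _ _ := Subtype.ext (G.mul_assoc _ _ _ _ _)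
  unit_mul _ := Subtype.ext (G.unit_mul _)
  mul_unit _ := Subtype.ext (G.mul_unit _)
  s_inv _ := Subtype.ext (G.s_inv _)
  r_inv _ := Subtype.ext (G.r_inv _)
  inv_mul _ := Subtype.ext (G.inv_mul _)
  mul_inv _ := Subtype.ext (G.mul_inv _)
  measurable_s := (G.measurable_s.comp measurable_subtype_coe).subtype_mk
  measurable_r := (G.measurable_r.comp measurable_subtype_coe).subtype_mk
  measurable_unit := (G.measurable_unit.comp measurable_subtype_coe).subtype_mk
  measurable_inv := (G.measurable_inv.comp measurable_subtype_coe).subtype_mk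
  measurable_mul := by
    refine Measurable.subtype_mk ?_
    have h : Measurable (fun p : {p : K.carrier × K.carrier //
        (⟨G.s p.1, K.s_mem p.1.2⟩ : K.obj) = ⟨G.r p.2, K.r_mem p.2.2⟩} =>
        (⟨((p.1.1 : 𝒢), (p.1.2 : 𝒢)), congrArg Subtype.val p.2⟩ :
          {p : 𝒢 × 𝒢 // G.s p.1 = G.r p.2})) := by
      refine Measurable.subtype_mk ?_
      exact (measurable_subtype_coe.comp (measurable_fst.comp measurable_subtype_coe)).prodMk
        (measurable_subtype_coe.comp (measurable_snd.comp measurable_subtype_coe))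
    exact G.measurable_mul.comp h

/-- The restriction of the measure on objects to the objects of `K`. -/
def restrictMeasure (μ : Measure X) : Measure K.obj := μ.comap Subtype.val

variable {K}

/-- The inclusion `⟦K⟧ ⊆ ⟦G⟧`. -/
def inclusion (f : PartialAut K.toGroupoid) : PartialAut G where
  carrier := Subtype.val '' f.carrier
  measurableSet := K.measurableSet.subtype_image f.measurableSet
  injOn_s := by
    rintro _ ⟨a, ha, rfl⟩ _ ⟨b, hb, rfl⟩ h
    rw [f.injOn_s ha hb (Subtype.ext h)]
  injOn_r := by
    rintro _ ⟨a, ha, rfl⟩ _ ⟨b, hb, rfl⟩ h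
    rw [f.injOn_r ha hb (Subtype.ext h)]

variable (K)

/-- The restriction of a random map `⟦G⟧ → ⟦d⟧` to `⟦K⟧`, on the level of laws. -/
def restrictLaw {d : ℕ} (P : Measure (SoficMap G d)) : Measure (SoficMap K.toGroupoid d) :=
  P.map fun σ f => σ (inclusion f)

end BorelSubgroupoid

variable {G : MeasurableGroupoid X 𝒢} {H : MeasurableGroupoid Y ℋ}

theorem GroupoidMorphism.obj_mem (π : GroupoidMorphism G H) {K : BorelSubgroupoid G}
    {L : BorelSubgroupoid H} (hKL : Set.MapsTo π.mor K.carrier L.carrier) {x : X}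
    (hx : x ∈ K.obj) : π.obj x ∈ L.obj := by
  have h : π.mor (G.unit x) ∈ L.carrier := hKL hx
  rw [π.map_unit] at h
  exact h

/-- The restriction of a morphism to subgroupoids. -/
def GroupoidMorphism.restrict (π : GroupoidMorphism G H) (K : BorelSubgroupoid G)
    (L : BorelSubgroupoid H) (hKL : Set.MapsTo π.mor K.carrier L.carrier) :
    GroupoidMorphism K.toGroupoid L.toGroupoid where
  obj x := ⟨π.obj x, π.obj_mem hKL x.2⟩
  mor g := ⟨π.mor g, hKL g.2⟩
  map_s g := Subtype.ext (π.map_s g)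
  map_r g := Subtype.ext (π.map_r g)
  map_unit x := Subtype.ext (π.map_unit x)
  map_inv g := Subtype.ext (π.map_inv g)
  map_mul g h e := Subtype.ext (π.map_mul g h (congrArg Subtype.val e))
  measurable_obj := (π.measurable_obj.comp measurable_subtype_coe).subtype_mk
  measurable_mor := (π.measurable_mor.comp measurable_subtype_coe).subtype_mk

end Subgroupoid

/-! ### Finite partitions and homomorphisms of set algebras -/

section Partition

variable {X : Type*}

/-- The smallest σ-algebra containing the sets in `S`, as an algebra of sets. -/
def sigmaAlg (S : Set (Set X)) : BooleanSubalgebra (Set X) where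
  carrier := {A | MeasurableSet[MeasurableSpace.generateFrom S] A}
  supClosed' A hA B hB := @MeasurableSet.union X (.generateFrom S) A B hA hB
  infClosed' A hA B hB := @MeasurableSet.inter X (.generateFrom S) A B hA hB
  compl_mem' {A} hA := @MeasurableSet.compl X A (.generateFrom S) hA
  bot_mem' := @MeasurableSet.empty X (.generateFrom S)

theorem finite_range_cells {S : Set (Set X)} (hS : S.Finite) :
    (Set.range fun x => {y | ∀ A ∈ S, x ∈ A ↔ y ∈ A}).Finite := by
  have h : (Set.range fun x => {y | ∀ A ∈ S, x ∈ A ↔ y ∈ A}) ⊆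
      (fun T : Set (Set X) => {y | ∀ A ∈ S, A ∈ T ↔ y ∈ A}) '' 𝒫 S := by
    rintro _ ⟨x, rfl⟩
    refine ⟨{A ∈ S | x ∈ A}, fun A hA => hA.1, ?_⟩
    ext y
    simp only [Set.mem_ofPred_eq]
    exact ⟨fun h A hA => by rw [← h A hA]; simp [hA], fun h A hA => by rw [← h A hA]; simp [hA]⟩
  exact (hS.finite_subsets.image _).subset h

open Classical in
/-- The coarsest partition of `X` for which every set of the finite family `S` is a union of
cells: two points lie in the same cell iff they lie in the same members of `S`. -/
def coarsestPartition (S : Set (Set X)) (hS : S.Finite) : Finpartition (Set.univ : Set X) where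
  parts := (finite_range_cells hS).toFinset
  supIndep := by
    rw [Finset.supIndep_iff_pairwiseDisjoint]
    intro A hA B hB hAB
    simp only [Finset.mem_coe, Set.Finite.mem_toFinset, Set.mem_range] at hA hB
    obtain ⟨x, rfl⟩ := hA
    obtain ⟨y, rfl⟩ := hB
    refine Set.disjoint_left.2 fun z hz hz' => hAB ?_
    ext w
    simp only [Set.mem_ofPred_eq, id] at hz hz' ⊢
    exact ⟨fun h C hC => by rw [hz' C hC, ← hz C hC, h C hC],
      fun h C hC => by rw [hz C hC, ← hz' C hC, h C hC]⟩
  sup_parts := by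
    refine Set.eq_univ_of_forall fun x => ?_
    rw [Finset.sup_id_set_eq_sUnion]
    refine ⟨{y | ∀ A ∈ S, x ∈ A ↔ y ∈ A}, ?_, fun _ _ => Iff.rfl⟩
    exact Finset.mem_coe.2 ((Set.Finite.mem_toFinset _).2 ⟨x, rfl⟩)
  bot_notMem := by
    intro h
    simp only [Set.Finite.mem_toFinset, Set.mem_range] at h
    obtain ⟨x, hx⟩ := h
    have : x ∈ (⊥ : Set X) := hx ▸ fun _ _ => Iff.rfl
    exact this

/-- A finite partition into Borel sets. -/
def IsBorelPartition [MeasurableSpace X] (P : Finpartition (Set.univ : Set X)) : Prop :=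
  ∀ A ∈ P.parts, MeasurableSet A

/-- Homomorphisms `Σ → B(Δ_d⁰)` from an algebra of sets to the algebra of all subsets of
`Δ_d⁰ = {1, …, d}`: maps preserving `∪`, `∩`, `∅` and the whole space. -/
abbrev SetHom (𝒮 : BooleanSubalgebra (Set X)) (d : ℕ) := BoundedLatticeHom 𝒮 (Set (Fin d))

open Classical in
/-- The value of a homomorphism at a set `A` in its domain. (Value `∅` off the domain, which is
never used: see `mem_sigmaAlg_of_mem_parts` and `translate_mem_sigmaAlg`.) -/
def SetHom.eval {𝒮 : BooleanSubalgebra (Set X)} {d : ℕ} (φ : SetHom 𝒮 d) (A : Set X) :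
    Set (Fin d) :=
  if h : A ∈ 𝒮 then φ ⟨A, h⟩ else ∅

end Partition

/-! ### Biases -/

/-- A bias for `J`: `-`, `+`, or an ultrafilter on `J` containing all tails. -/
inductive Bias (J : Type*) [Preorder J]
  | minus
  | plus
  | ultra (U : Ultrafilter J) (h : ∀ j, {j' | j ≤ j'} ∈ U)

/-- `lim_{j → β} Φ(j)`: the lower limit, the upper limit or the ultralimit, in `[-∞, ∞]`. -/
def Bias.lim {J : Type*} [Preorder J] (β : Bias J) (Φ : J → EReal) : EReal :=
  match β with
  | .minus => liminf Φ atTop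
  | .plus => limsup Φ atTop
  | .ultra U _ => limUnder (U : Filter J) Φ

/-- Ultralimits exist in the compact space `[-∞, ∞]`. -/
theorem Bias.tendsto_lim {J : Type*} [Preorder J] (U : Ultrafilter J)
    (h : ∀ j, {j' | j ≤ j'} ∈ U) (Φ : J → EReal) :
    Tendsto Φ U (𝓝 ((Bias.ultra U h).lim Φ)) := by
  obtain ⟨x, -, hx⟩ := isCompact_univ.ultrafilter_le_nhds (U.map Φ) (by simp)
  exact tendsto_nhds_limUnder ⟨x, hx⟩

/-! ### Sofic measure entropy -/

section Entropy

variable {X 𝒢 Y ℋ : Type*} [MeasurableSpace X] [MeasurableSpace 𝒢] [MeasurableSpace Y]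
  [MeasurableSpace ℋ] {G : MeasurableGroupoid X 𝒢} {H : MeasurableGroupoid Y ℋ}

/-- `f · A = r (π⁻¹(f) A)` for `f ∈ ⟦H⟧` and a set `A` of objects of `G`. -/
def GroupoidMorphism.act (π : GroupoidMorphism G H) (f : PartialAut H) (A : Set X) : Set X :=
  G.translate (π.mor ⁻¹' f.carrier) A

/-- The family `{f · A : f ∈ F, A ∈ P}`. -/
def translates (π : GroupoidMorphism G H) (P : Finpartition (Set.univ : Set X))
    (F : Finset (PartialAut H)) : Set (Set X) :=
  Set.image2 π.act F P.parts

/-- `P^F`, the coarsest partition for which all `f · A` (`f ∈ F`, `A ∈ P`) are unions of cells. -/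
def translatePartition (π : GroupoidMorphism G H) (P : Finpartition (Set.univ : Set X))
    (F : Finset (PartialAut H)) : Finpartition (Set.univ : Set X) :=
  coarsestPartition (translates π P F) (F.finite_toSet.image2 _ P.parts.finite_toSet)

/-- `Σ(P)` for a finite partition `P`. -/
abbrev sigmaPartition (P : Finpartition (Set.univ : Set X)) : BooleanSubalgebra (Set X) :=
  sigmaAlg (P.parts : Set (Set X))

/-- `Hom(π, σ, P, F, δ)`: homomorphisms `φ : Σ(P^F) → B(Δ_d⁰)` with
`∑_{A ∈ P} |σ_f · φ(A) ∆ φ(f · A)| / d < δ` for all `f ∈ F`, and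
`∑_{A ∈ P^F} | |φ(A)| / d - μ(A) | < δ`. -/
def goodHoms (π : GroupoidMorphism G H) (μ : Measure X) {d : ℕ} (σ : SoficMap H d)
    (P : Finpartition (Set.univ : Set X)) (F : Finset (PartialAut H)) (δ : ℝ) :
    Set (SetHom (sigmaPartition (translatePartition π P F)) d) :=
  {φ | (∀ f ∈ F, ∑ A ∈ P.parts,
        ((((fullGroupoid d).translate (σ f).carrier (φ.eval A)) ∆ (φ.eval (π.act f A))).ncard : ℝ)
          / d < δ) ∧
      ∑ A ∈ (translatePartition π P F).parts, |((φ.eval A).ncard : ℝ) / d - μ.real A| < δ}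

/-- `|Hom(π, σ, P, F, δ)|_Q`: the number of homomorphisms `Σ(Q) → B(Δ_d⁰)` which are restrictions
of elements of `Hom(π, σ, P, F, δ)`. -/
def homCount (π : GroupoidMorphism G H) (μ : Measure X) {d : ℕ} (σ : SoficMap H d)
    (Q P : Finpartition (Set.univ : Set X)) (F : Finset (PartialAut H)) (δ : ℝ) : ℕ :=
  {ψ : SetHom (sigmaPartition Q) d | ∃ φ ∈ goodHoms π μ σ P F δ,
    ∀ A : sigmaPartition Q, ∃ hA : (A : Set X) ∈ sigmaPartition (translatePartition π P F),
      ψ A = φ ⟨A, hA⟩}.ncard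

/-- `h(π, Q, P, F, δ) = lim_{j → β} (1 / d_j) log ‖ |Hom(π, ·, P, F, δ)|_Q ‖_{p, P_j}`. -/
def entropyAt (π : GroupoidMorphism G H) (μ : Measure X) {J : Type*} [Preorder J] (d : J → ℕ)
    (ℙ : ∀ j, Measure (SoficMap H (d j))) (p : ℝ≥0∞) (β : Bias J)
    (Q P : Finpartition (Set.univ : Set X)) (F : Finset (PartialAut H)) (δ : ℝ) : EReal :=
  β.lim fun j =>
    ENNReal.log (eLpNorm (fun σ => (homCount π μ σ Q P F δ : ℝ)) p (ℙ j)) / ((d j : ℝ) : EReal)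

/-- The sofic measure entropy of a class-bijective extension `π`, with respect to the family `ℙ`,
the exponent `p` and the bias `β`: the supremum over finite Borel partitions `Q` of the infimum
over finite Borel partitions `P` refining `Q`, finite `F ⊆ ⟦H⟧` containing the unit space, and
`δ > 0`, of `h(π, Q, P, F, δ)`. (In Mathlib's order on `Finpartition`, `P ≤ Q` says that `P`
refines `Q`.) -/
def entropy (π : GroupoidMorphism G H) (μ : Measure X) {J : Type*} [Preorder J] (d : J → ℕ)
    (ℙ : ∀ j, Measure (SoficMap H (d j))) (p : ℝ≥0∞) (β : Bias J) : EReal :=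
  ⨆ (Q : Finpartition (Set.univ : Set X)) (_ : IsBorelPartition Q),
    ⨅ (P : Finpartition (Set.univ : Set X)) (_ : IsBorelPartition P) (_ : P ≤ Q),
      ⨅ (F : Finset (PartialAut H)) (_ : PartialAut.one H ∈ F),
        ⨅ (δ : ℝ) (_ : 0 < δ), entropyAt π μ d ℙ p β Q P F δ

/-- The sets `f · A` (`f ∈ F`, `A ∈ P`) belong to `Σ(P^F)`. -/
theorem translate_mem_sigmaAlg (π : GroupoidMorphism G H) (P : Finpartition (Set.univ : Set X))
    (F : Finset (PartialAut H)) {f : PartialAut H} (hf : f ∈ F) {A : Set X} (hA : A ∈ P.parts) :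
    π.act f A ∈ sigmaPartition (translatePartition π P F) := by
  have hfin : (translates π P F).Finite := F.finite_toSet.image2 _ P.parts.finite_toSet
  have hmem : π.act f A ∈ translates π P F := ⟨f, hf, A, hA, rfl⟩
  have heq : π.act f A = ⋃₀ {C | C ∈ (translatePartition π P F).parts ∧ C ⊆ π.act f A} := by
    ext x
    constructor
    · intro hx
      refine ⟨{y | ∀ B ∈ translates π P F, x ∈ B ↔ y ∈ B}, ⟨?_, ?_⟩, fun _ _ => Iff.rfl⟩
      · exact (finite_range_cells hfin).mem_toFinset.2 ⟨x, rfl⟩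
      · exact fun y hy => (hy _ hmem).1 hx
    · rintro ⟨C, ⟨-, hC⟩, hx⟩
      exact hC hx
  rw [heq]
  refine @MeasurableSet.sUnion _ (MeasurableSpace.generateFrom _) _ ?_ ?_
  · exact (((translatePartition π P F).parts.finite_toSet).subset fun C hC => hC.1).countable
  · exact fun C hC => MeasurableSpace.measurableSet_generateFrom hC.1

/-- For a class-bijective extension, `H⁰ · A = A`. -/
theorem act_one (π : GroupoidMorphism G H) (hπ : π.IsClassBijectiveExtension) (A : Set X) :
    π.act (PartialAut.one H) A = A := by
  ext x
  constructor
  · rintro ⟨g, ⟨⟨y, hy⟩, hg⟩, rfl⟩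
    have h1 : π.obj (G.s g) = y := by rw [← π.map_s, ← hy, H.s_unit]
    have h2 : g = G.unit (G.s g) := by
      refine (hπ.bijOn_s (G.s g)).injOn rfl (G.s_unit _) ?_
      rw [π.map_unit, h1, hy]
    rw [h2, G.r_unit]
    exact hg
  · intro hx
    exact ⟨G.unit x, ⟨⟨π.obj x, (π.map_unit x).symm⟩, by rwa [G.s_unit]⟩, G.r_unit x⟩

/-- The members of `P` belong to `Σ(P^F)` when `F` contains the unit space. -/
theorem mem_sigmaAlg_of_mem_parts (π : GroupoidMorphism G H) (hπ : π.IsClassBijectiveExtension)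
    (P : Finpartition (Set.univ : Set X)) (F : Finset (PartialAut H))
    (hF : PartialAut.one H ∈ F) {A : Set X} (hA : A ∈ P.parts) :
    A ∈ sigmaPartition (translatePartition π P F) := by
  have h := translate_mem_sigmaAlg π P F hF hA
  rwa [act_one π hπ] at h

/-! ### Restrictions that are class-bijective extensions -/

/-- Conull Borel subgroupoids `K ⊆ G` and `L ⊆ H` such that `π` restricts to a class-bijective
extension `K → L`. -/
structure ClassBijectiveRestriction (π : GroupoidMorphism G H) (μ : Measure X) (ν : Measure Y)
    where
  K : BorelSubgroupoid G
  L : BorelSubgroupoid H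
  conull_K : K.IsConull μ
  conull_L : L.IsConull ν
  mapsTo : Set.MapsTo π.mor K.carrier L.carrier
  classBijective : (π.restrict K L mapsTo).IsClassBijectiveExtension

/-- The entropy of the restriction `K → L`, computed with the restriction of the sofic
approximation to `⟦L⟧ ⊆ ⟦H⟧`. -/
def ClassBijectiveRestriction.entropy {π : GroupoidMorphism G H} {μ : Measure X} {ν : Measure Y}
    (R : ClassBijectiveRestriction π μ ν) {J : Type*} [Preorder J] (d : J → ℕ)
    (ℙ : ∀ j, Measure (SoficMap H (d j))) (p : ℝ≥0∞) (β : Bias J) : EReal :=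
  SoficEntropy.entropy (π.restrict R.K R.L R.mapsTo) (R.K.restrictMeasure μ) d
    (fun j => R.L.restrictLaw (ℙ j)) p β

end Entropy

end SoficEntropy

end

noncomputable section

namespace SoficEntropy

/-! Two restrictions K₁ → L₁ and K₂ → L₂ of π differ only on null sets. Their object spaces are
compared by a map `T` that is the identity on the overlap and constant elsewhere, and ⟦L₂⟧ is sent
to ⟦L₁⟧ by f ↦ f ∩ L₁. The `null` clause of a sofic approximation gives f and f ∩ L₁ almost surely
the same image. The actions also agree up to null sets: they coincide at every x for which all
arrows with range x lie in K₁ ∩ K₂, and the exceptional points lie in the ranges of the complements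
of K₁ and K₂. Those ranges are null because μ_s = μ_r (`measure_image_r_eq_zero`).

If φ is an approximate homomorphism for the first extension, on a fine enough partition, then A ↦
φ(T⁻¹A) is one for the second (`pullback_mem_goodHoms`): φ almost preserves measure, so it sends
each null discrepancy to a set of small density. Since φ need not send null sets to ∅, this pullback
may lose information about φ on Q₁. What is lost is recorded by one small set per cell C of Q₁,
namely the image under φ of the null set on which C and its round trip through the other space
differ (`homCount_le`). There are at most exp(εd) small subsets of {1, …, d}
(`smallSubsetCount_le`), so the entropies compare up to an arbitrary ε (`entropy_le_of_ae_iso`).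
Exchanging the roles of the restrictions gives equality. -/

/-! ### Null analytic sets and ranges of null sets of arrows -/

theorem exists_forall_lt_subset_of_isOpen (n : ℕ → ℕ) {W : Set (ℕ → ℕ)} (hW : IsOpen W)
    (h : {x : ℕ → ℕ | ∀ i, x i ≤ n i} ⊆ W) : ∃ k, {x : ℕ → ℕ | ∀ i < k, x i ≤ n i} ⊆ W := by
  by_contra! hc
  simp only [Set.not_subset] at hc
  choose x hx hxW using hc
  have hK : IsCompact {x : ℕ → ℕ | ∀ i, x i ≤ n i} := by
    have : {x : ℕ → ℕ | ∀ i, x i ≤ n i} = Set.univ.pi fun i => Set.Iic (n i) := by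
      ext x; simp [Pi.le_def]
    rw [this]
    exact isCompact_univ_pi fun i => (Set.finite_Iic _).isCompact
  obtain ⟨y, hy, φ, hφ, hlim⟩ := hK.tendsto_subseq (x := fun k i => min (x k i) (n i))
    fun k i => min_le_right _ _
  -- Truncation alters `x k` only in coordinates from k on, so each fixed coordinate is eventually
  -- unaffected and the untruncated points have the same limit.
  have hlim' : Tendsto (x ∘ φ) atTop (𝓝 y) := by
    rw [tendsto_pi_nhds] at hlim ⊢
    intro i
    refine (hlim i).congr' ?_
    filter_upwards [eventually_gt_atTop i] with k hk
    exact min_eq_left (hx _ i (hk.trans_le (hφ.id_le k)))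
  exact hW.isClosed_compl.mem_of_tendsto hlim' (Eventually.of_forall fun k => hxW _) (h hy)

/-- An analytic set all of whose Borel subsets are null is itself null. -/
theorem measure_eq_zero_of_analyticSet {X : Type*} [TopologicalSpace X] [PolishSpace X]
    [MeasurableSpace X] [BorelSpace X] (μ : Measure X) [IsFiniteMeasure μ] {A : Set X}
    (hA : AnalyticSet A) (h : ∀ B ⊆ A, MeasurableSet B → μ B = 0) : μ A = 0 := by
  rw [AnalyticSet] at hA
  rcases hA with rfl | ⟨g, hg, rfl⟩
  · simp
  by_contra hne
  obtain ⟨c, hc0, hc⟩ := exists_between (pos_iff_ne_zero.2 hne)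
  -- Continuity from below holds for arbitrary sets, measurable or not, so the coordinates can be
  -- bounded one at a time while the image keeps outer measure above `c`.
  have step : ∀ S : Set (ℕ → ℕ), c < μ (g '' S) → ∀ k, ∃ m, c < μ (g '' {x ∈ S | x k ≤ m}) := by
    intro S hS k
    have hmono : Monotone fun m => g '' {x ∈ S | x k ≤ m} := fun a b hab =>
      Set.image_mono fun x hx => ⟨hx.1, hx.2.trans hab⟩
    have hU : ⋃ m, g '' {x ∈ S | x k ≤ m} = g '' S := by
      rw [← Set.image_iUnion]
      congr 1
      ext x
      simp only [Set.mem_iUnion, Set.mem_ofPred_eq, exists_and_left, and_iff_left_iff_imp]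
      exact fun _ => ⟨x k, le_rfl⟩
    rw [← hU, hmono.measure_iUnion] at hS
    exact lt_iSup_iff.1 hS
  choose! m hm using step
  let S : ℕ → Set (ℕ → ℕ) := fun k => Nat.rec Set.univ (fun k S => {x ∈ S | x k ≤ m S k}) k
  have hS : ∀ k, c < μ (g '' S k) := by
    intro k
    induction k with
    | zero => simpa [S] using hc
    | succ k ih => exact hm _ ih k
  have hSeq : ∀ k, S k = {x | ∀ i < k, x i ≤ m (S i) i} := by
    intro k
    induction k with
    | zero => simp [S]
    | succ k ih =>
      change {x ∈ S k | x k ≤ m (S k) k} = _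
      ext x
      simp only [Set.mem_ofPred_eq, Nat.forall_lt_succ_right]
      rw [ih]
      rfl
  set K := {x : ℕ → ℕ | ∀ i, x i ≤ m (S i) i}
  have hK : IsCompact K := by
    have : K = Set.univ.pi fun i => Set.Iic (m (S i) i) := by
      ext x; simp [K, Pi.le_def]
    rw [this]
    exact isCompact_univ_pi fun i => (Set.finite_Iic _).isCompact
  -- The image of the compact box is compact, hence Borel and null, and has an open neighbourhood of
  -- measure below `c`. The preimage of that neighbourhood contains some `S k`, whose image has
  -- measure above `c`.
  have h0 := h (g '' K) (Set.image_subset_range _ _) (hK.image hg).measurableSet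
  obtain ⟨V, hV, hVo, hVc⟩ := (g '' K).exists_isOpen_lt_of_lt c (h0 ▸ hc0)
  obtain ⟨k, hk⟩ := exists_forall_lt_subset_of_isOpen (fun i => m (S i) i)
    (hVo.preimage hg) (Set.image_subset_iff.1 hV)
  rw [← hSeq] at hk
  exact absurd ((hS k).trans_le (measure_mono (Set.image_subset_iff.2 hk))) hVc.not_gt

section

variable {X 𝒢 Y ℋ : Type*} [MeasurableSpace X] [MeasurableSpace 𝒢] [MeasurableSpace Y]
  [MeasurableSpace ℋ] {G : MeasurableGroupoid X 𝒢} {H : MeasurableGroupoid Y ℋ}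

theorem measS_mono (μ : Measure X) {B C : Set 𝒢} (h : B ⊆ C) :
    G.measS μ B ≤ G.measS μ C := by
  refine lintegral_mono fun x => ?_
  exact ENat.toENNReal_mono (Set.encard_le_encard (Set.inter_subset_inter_right _ h))

/-- The range image is handled as an analytic set, so it suffices to bound its Borel subsets B. Each
fibre r⁻¹(x) with x ∈ B meets `N`, whence μ(B) ≤ μ_r(N) = μ_s(N) = 0. -/
theorem measure_image_r_eq_zero {μ : Measure X} (hG : G.IsDiscretePMP μ) {N : Set 𝒢}
    (hN : MeasurableSet N) (h0 : G.measS μ N = 0) : μ (G.r '' N) = 0 := by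
  have := G.standardBorel_obj
  have := G.standardBorel_mor
  have := hG.isProbabilityMeasure
  let _ := upgradeStandardBorel X
  refine measure_eq_zero_of_analyticSet μ (hN.analyticSet_image G.measurable_r) ?_
  intro B hB hBm
  rw [hG.measS_eq_measR N hN] at h0
  rw [← nonpos_iff_eq_zero, ← h0, ← lintegral_indicator_one hBm]
  refine lintegral_mono fun x => ?_
  by_cases hx : x ∈ B
  · obtain ⟨g, hg, rfl⟩ := hB hx
    rw [Set.indicator_of_mem hx]
    have : (1 : ℕ∞) ≤ (G.r ⁻¹' {G.r g} ∩ N).encard :=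
      Set.one_le_encard_iff_nonempty.2 ⟨g, rfl, hg⟩
    exact ENat.toENNReal_mono this |>.trans' (by simp)
  · simp [Set.indicator_of_notMem hx]

/-- Class-bijectivity on range fibres, with injectivity of r on f, makes r injective on π⁻¹(f). An
injective Borel image of a Borel set is Borel. -/
theorem GroupoidMorphism.measurableSet_act (π : GroupoidMorphism G H)
    (hπ : π.IsClassBijectiveExtension) (f : PartialAut H) {A : Set X} (hA : MeasurableSet A) :
    MeasurableSet (π.act f A) := by
  have := G.standardBorel_obj
  have := G.standardBorel_mor
  refine MeasurableSet.image_of_measurable_injOn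
    ((π.measurable_mor f.measurableSet).inter (G.measurable_s hA)) G.measurable_r ?_
  rintro g ⟨hg, -⟩ g' ⟨hg', -⟩ h
  refine (hπ.bijOn_r (G.r g)).injOn rfl h.symm (f.injOn_r hg hg' ?_)
  rw [π.map_r, π.map_r, h]

end

/-! ### Algebras of finite partitions and their homomorphisms -/

section

variable {X X' : Type*}

/-- The sets whose preimage lies in the target algebra form a σ-algebra, so generators suffice. With
`T = id` this compares two algebras on one space. -/
theorem preimage_mem_sigmaAlg {S : Set (Set X)} {S' : Set (Set X')} (T : X' → X)
    (h : ∀ A ∈ S, T ⁻¹' A ∈ sigmaAlg S') {A : Set X} (hA : A ∈ sigmaAlg S) :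
    T ⁻¹' A ∈ sigmaAlg S' :=
  MeasurableSpace.generateFrom_le (m := (MeasurableSpace.generateFrom S').map T) h A hA

theorem subset_sigmaAlg {S : Set (Set X)} {A : Set X} (hA : A ∈ S) : A ∈ sigmaAlg S :=
  MeasurableSpace.measurableSet_generateFrom hA

theorem exists_mem_parts (P : Finpartition (Set.univ : Set X)) (x : X) :
    ∃ C ∈ P.parts, x ∈ C := by
  have h := Set.mem_univ x
  rw [← P.sup_parts, Finset.sup_id_set_eq_sUnion] at h
  exact h

/-- For a fixed cell, the sets satisfying this dichotomy form a σ-algebra containing all cells. -/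
theorem subset_or_disjoint_of_mem_sigmaPartition {P : Finpartition (Set.univ : Set X)}
    {A : Set X} (hA : A ∈ sigmaPartition P) {C : Set X} (hC : C ∈ P.parts) :
    C ⊆ A ∨ Disjoint C A := by
  refine MeasurableSpace.generateFrom_induction (P.parts : Set (Set X))
    (fun A _ => C ⊆ A ∨ Disjoint C A) ?_ ?_ ?_ ?_ A hA
  · intro B hB _
    rcases eq_or_ne C B with rfl | h
    · exact Or.inl subset_rfl
    · exact Or.inr (P.disjoint hC hB h)
  · exact Or.inr (Set.disjoint_empty _)
  · rintro B _ (h | h)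
    · exact Or.inr (Set.disjoint_left.2 fun x hx hx' => hx' (h hx))
    · exact Or.inl fun x hx hx' => Set.disjoint_left.1 h hx hx'
  · intro s _ h
    by_cases hs : ∃ n, C ⊆ s n
    · obtain ⟨n, hn⟩ := hs
      exact Or.inl (hn.trans (Set.subset_iUnion _ _))
    · push Not at hs
      exact Or.inr (Set.disjoint_iUnion_right.2 fun n => (h n).resolve_left (hs n))

open Classical in
/-- The cells of `P` contained in `A`. -/
def cellsIn (P : Finpartition (Set.univ : Set X)) (A : Set X) : Finset (Set X) :=
  P.parts.filter (· ⊆ A)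

theorem mem_cellsIn {P : Finpartition (Set.univ : Set X)} {A C : Set X} :
    C ∈ cellsIn P A ↔ C ∈ P.parts ∧ C ⊆ A := by
  simp [cellsIn]

theorem biUnion_cellsIn {P : Finpartition (Set.univ : Set X)} {A : Set X}
    (hA : A ∈ sigmaPartition P) : ⋃ C ∈ cellsIn P A, C = A := by
  ext x
  simp only [Set.mem_iUnion, mem_cellsIn, exists_prop]
  constructor
  · rintro ⟨C, ⟨-, hC⟩, hx⟩
    exact hC hx
  · intro hx
    obtain ⟨C, hC, hxC⟩ := exists_mem_parts P x
    refine ⟨C, ⟨hC, ?_⟩, hxC⟩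
    exact (subset_or_disjoint_of_mem_sigmaPartition hA hC).resolve_right
      fun h => Set.disjoint_left.1 h hxC hx

theorem pairwiseDisjoint_cellsIn (P : Finpartition (Set.univ : Set X)) (A : Set X) :
    (cellsIn P A : Set (Set X)).PairwiseDisjoint id :=
  fun _ hC _ hC' h => P.disjoint (mem_cellsIn.1 hC).1 (mem_cellsIn.1 hC').1 h

/-- Cells are nonempty, so none lies in two disjoint sets and no weight is counted twice. This is
what keeps total errors from being multiplied by the number of sets. -/
theorem sum_sum_cellsIn_le {ι : Type*} (s : Finset ι) (g : ι → Set X)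
    (hg : (s : Set ι).PairwiseDisjoint g) (P : Finpartition (Set.univ : Set X))
    (w : Set X → ℝ) (hw : ∀ C, 0 ≤ w C) :
    ∑ i ∈ s, ∑ C ∈ cellsIn P (g i), w C ≤ ∑ C ∈ P.parts, w C := by
  classical
  rw [← Finset.sum_biUnion]
  · refine Finset.sum_le_sum_of_subset_of_nonneg ?_ fun C _ _ => hw C
    intro C hC
    obtain ⟨i, -, hi⟩ := Finset.mem_biUnion.1 hC
    exact (mem_cellsIn.1 hi).1
  · intro i hi j hj hij
    refine Finset.disjoint_left.2 fun C hC hC' => ?_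
    rw [mem_cellsIn] at hC hC'
    exact P.ne_bot hC.1 (Set.subset_empty_iff.1
      ((hg hi hj hij).le_bot.trans' (Set.subset_inter hC.2 hC'.2)))

/-- A member of the algebra is determined by the cells it contains. Finiteness is needed because
`homCount` is an `ncard`, which would be 0 on an infinite set. -/
instance (P : Finpartition (Set.univ : Set X)) : Finite (sigmaPartition P) :=
  Finite.of_injective (β := P.parts.powerset)
    (fun A => ⟨cellsIn P A, Finset.mem_powerset.2 fun _ hC => (mem_cellsIn.1 hC).1⟩)
    fun A B h => Subtype.ext <| by
      rw [← biUnion_cellsIn A.2, ← biUnion_cellsIn B.2, Subtype.mk.inj h]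

instance (P : Finpartition (Set.univ : Set X)) (d : ℕ) : Finite (SetHom (sigmaPartition P) d) :=
  DFunLike.finite _

theorem mem_sigmaPartition_coarsestPartition {S : Set (Set X)} (hS : S.Finite) {A : Set X}
    (hA : A ∈ S) : A ∈ sigmaPartition (coarsestPartition S hS) := by
  have heq : A = ⋃₀ {C | C ∈ (coarsestPartition S hS).parts ∧ C ⊆ A} := by
    ext x
    constructor
    · intro hx
      refine ⟨{y | ∀ B ∈ S, x ∈ B ↔ y ∈ B}, ⟨?_, ?_⟩, fun _ _ => Iff.rfl⟩
      · exact (finite_range_cells hS).mem_toFinset.2 ⟨x, rfl⟩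
      · exact fun y hy => (hy _ hA).1 hx
    · rintro ⟨C, ⟨-, hC⟩, hx⟩
      exact hC hx
  rw [heq]
  refine @MeasurableSet.sUnion _ (MeasurableSpace.generateFrom _) _ ?_ ?_
  · exact (((coarsestPartition S hS).parts.finite_toSet).subset fun C hC => hC.1).countable
  · exact fun C hC => MeasurableSpace.measurableSet_generateFrom hC.1

theorem isBorelPartition_coarsestPartition [MeasurableSpace X] {S : Set (Set X)} (hS : S.Finite)
    (h : ∀ A ∈ S, MeasurableSet A) : IsBorelPartition (coarsestPartition S hS) := by
  intro C hC
  obtain ⟨x, rfl⟩ := (finite_range_cells hS).mem_toFinset.1 hC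
  have heq : {y | ∀ A ∈ S, x ∈ A ↔ y ∈ A} = ⋂ A ∈ S, {y | x ∈ A ↔ y ∈ A} := by
    ext y; simp
  change MeasurableSet {y | ∀ A ∈ S, x ∈ A ↔ y ∈ A}
  rw [heq]
  refine MeasurableSet.biInter hS.countable fun A hA => ?_
  by_cases hx : x ∈ A
  · simpa [hx] using h A hA
  · have : {y | x ∈ A ↔ y ∈ A} = Aᶜ := by ext y; simp [hx]
    exact this ▸ (h A hA).compl

theorem coarsestPartition_le {S : Set (Set X)} (hS : S.Finite)
    {Q : Finpartition (Set.univ : Set X)} (h : ∀ A ∈ Q.parts, A ∈ S) :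
    coarsestPartition S hS ≤ Q := by
  intro C hC
  obtain ⟨x, rfl⟩ := (finite_range_cells hS).mem_toFinset.1 hC
  obtain ⟨A, hA, hx⟩ := exists_mem_parts Q x
  exact ⟨A, hA, fun y hy => (hy A (h A hA)).1 hx⟩

theorem mem_sigmaPartition_of_le {P Q : Finpartition (Set.univ : Set X)} (h : P ≤ Q) {A : Set X}
    (hA : A ∈ sigmaPartition Q) : A ∈ sigmaPartition P := by
  refine preimage_mem_sigmaAlg id (fun C hC => ?_) hA
  have : C = ⋃₀ {B | B ∈ P.parts ∧ B ⊆ C} := by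
    ext x
    constructor
    · intro hx
      obtain ⟨B, hB, hxB⟩ := exists_mem_parts P x
      obtain ⟨C', hC', hBC⟩ := h hB
      refine ⟨B, ⟨hB, ?_⟩, hxB⟩
      by_contra hne
      exact Set.disjoint_left.1 (Q.disjoint hC hC' fun e => hne (e ▸ hBC)) hx (hBC hxB)
    · rintro ⟨B, ⟨-, hB⟩, hx⟩
      exact hB hx
  rw [Set.preimage_id, this]
  refine @MeasurableSet.sUnion _ (MeasurableSpace.generateFrom _) _ ?_ ?_
  · exact (P.parts.finite_toSet.subset fun C hC => hC.1).countable
  · exact fun C hC => MeasurableSpace.measurableSet_generateFrom hC.1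

theorem IsBorelPartition.measurableSet [MeasurableSpace X] {P : Finpartition (Set.univ : Set X)}
    (hP : IsBorelPartition P) {A : Set X} (hA : A ∈ sigmaPartition P) : MeasurableSet A :=
  MeasurableSpace.generateFrom_le hP A hA

namespace SetHom

variable {𝒮 : BooleanSubalgebra (Set X)} {d : ℕ} (φ : SetHom 𝒮 d) {A B : Set X}

theorem eval_of_mem (h : A ∈ 𝒮) : φ.eval A = φ ⟨A, h⟩ := dif_pos h

theorem eval_empty : φ.eval ∅ = ∅ :=
  (eval_of_mem φ (A := ∅) 𝒮.bot_mem).trans (map_bot φ)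

theorem eval_union (hA : A ∈ 𝒮) (hB : B ∈ 𝒮) : φ.eval (A ∪ B) = φ.eval A ∪ φ.eval B := by
  rw [eval_of_mem φ hA, eval_of_mem φ hB, eval_of_mem φ (A := A ∪ B) (𝒮.sup_mem hA hB)]
  exact map_sup φ (⟨A, hA⟩ : 𝒮) ⟨B, hB⟩

theorem eval_inter (hA : A ∈ 𝒮) (hB : B ∈ 𝒮) : φ.eval (A ∩ B) = φ.eval A ∩ φ.eval B := by
  rw [eval_of_mem φ hA, eval_of_mem φ hB, eval_of_mem φ (A := A ∩ B) (𝒮.inf_mem hA hB)]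
  exact map_inf φ (⟨A, hA⟩ : 𝒮) ⟨B, hB⟩

theorem symmDiff_mem (hA : A ∈ 𝒮) (hB : B ∈ 𝒮) : A ∆ B ∈ 𝒮 :=
  𝒮.sup_mem (𝒮.sdiff_mem hA hB) (𝒮.sdiff_mem hB hA)

theorem eval_symmDiff (hA : A ∈ 𝒮) (hB : B ∈ 𝒮) : φ.eval (A ∆ B) = φ.eval A ∆ φ.eval B := by
  rw [eval_of_mem φ hA, eval_of_mem φ hB, eval_of_mem φ (symmDiff_mem hA hB)]
  exact map_symmDiff' φ ⟨A, hA⟩ ⟨B, hB⟩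

theorem biUnion_mem {ι : Type*} (s : Finset ι) (g : ι → Set X) (hg : ∀ i ∈ s, g i ∈ 𝒮) :
    ⋃ i ∈ s, g i ∈ 𝒮 := by
  classical
  induction s using Finset.induction_on with
  | empty => simpa using 𝒮.bot_mem
  | insert a s ha ih =>
    rw [Finset.set_biUnion_insert]
    exact 𝒮.sup_mem (hg _ (Finset.mem_insert_self _ _))
      (ih fun i hi => hg i (Finset.mem_insert_of_mem hi))

theorem eval_biUnion {ι : Type*} (s : Finset ι) (g : ι → Set X) (hg : ∀ i ∈ s, g i ∈ 𝒮) :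
    φ.eval (⋃ i ∈ s, g i) = ⋃ i ∈ s, φ.eval (g i) := by
  classical
  induction s using Finset.induction_on with
  | empty => simpa using φ.eval_empty
  | insert a s ha ih =>
    have hs : ∀ i ∈ s, g i ∈ 𝒮 := fun i hi => hg i (Finset.mem_insert_of_mem hi)
    rw [Finset.set_biUnion_insert, Finset.set_biUnion_insert,
      φ.eval_union (hg _ (Finset.mem_insert_self _ _)) (biUnion_mem s g hs), ih hs]

theorem ext_parts {P : Finpartition (Set.univ : Set X)} {φ ψ : SetHom (sigmaPartition P) d}
    (h : ∀ C ∈ P.parts, φ.eval C = ψ.eval C) : φ = ψ := by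
  refine DFunLike.ext _ _ fun A => ?_
  have hmem : ∀ C ∈ cellsIn P (A : Set X), C ∈ sigmaPartition P := fun C hC =>
    subset_sigmaAlg (mem_cellsIn.1 hC).1
  rw [← φ.eval_of_mem A.2, ← ψ.eval_of_mem A.2, ← biUnion_cellsIn A.2,
    eval_biUnion _ _ _ hmem, eval_biUnion _ _ _ hmem]
  exact Set.iUnion₂_congr fun C hC => h C (mem_cellsIn.1 hC).1

/-- The homomorphism `A ↦ φ (T⁻¹ A)`. -/
def pullback {𝒮' : BooleanSubalgebra (Set X')} (T : X → X') (h : ∀ A ∈ 𝒮', T ⁻¹' A ∈ 𝒮) :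
    SetHom 𝒮' d where
  toFun A := φ ⟨T ⁻¹' A, h A A.2⟩
  map_sup' A B := map_sup φ (⟨T ⁻¹' A, h A A.2⟩ : 𝒮) ⟨T ⁻¹' B, h B B.2⟩
  map_inf' A B := map_inf φ (⟨T ⁻¹' A, h A A.2⟩ : 𝒮) ⟨T ⁻¹' B, h B B.2⟩
  map_top' := map_top φ
  map_bot' := map_bot φ

theorem eval_pullback {𝒮' : BooleanSubalgebra (Set X')} (T : X → X')
    (h : ∀ A ∈ 𝒮', T ⁻¹' A ∈ 𝒮) {A : Set X'} (hA : A ∈ 𝒮') :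
    (φ.pullback T h).eval A = φ.eval (T ⁻¹' A) := by
  rw [eval_of_mem _ hA, eval_of_mem _ (h A hA)]
  rfl

/-- The deviation of `φ` from preserving the measure of `A` is at most its total deviation on the
cells in `A`. -/
theorem abs_ncard_eval_sub_le [MeasurableSpace X] (μ : Measure X) [IsFiniteMeasure μ]
    {P : Finpartition (Set.univ : Set X)} (hP : IsBorelPartition P)
    (φ : SetHom (sigmaPartition P) d) (hA : A ∈ sigmaPartition P) :
    |((φ.eval A).ncard : ℝ) / d - μ.real A| ≤
      ∑ C ∈ cellsIn P A, |((φ.eval C).ncard : ℝ) / d - μ.real C| := by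
  have hmem : ∀ C ∈ cellsIn P A, C ∈ sigmaPartition P := fun C hC =>
    subset_sigmaAlg (mem_cellsIn.1 hC).1
  have h1 : μ.real A = ∑ C ∈ cellsIn P A, μ.real C := by
    conv_lhs => rw [← biUnion_cellsIn hA]
    exact measureReal_biUnion_finset (pairwiseDisjoint_cellsIn P A)
      fun C hC => hP C (mem_cellsIn.1 hC).1
  have h2 : (φ.eval A).ncard = ∑ C ∈ cellsIn P A, (φ.eval C).ncard := by
    conv_lhs => rw [← biUnion_cellsIn hA, eval_biUnion _ _ _ hmem]
    rw [← finsum_mem_finset_eq_sum]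
    refine (cellsIn P A).finite_toSet.ncard_biUnion (fun _ _ => Set.toFinite _) ?_
    intro C hC C' hC' hne
    rw [Function.onFun, Set.disjoint_iff_inter_eq_empty, ← φ.eval_inter (hmem C hC) (hmem C' hC'),
      (Set.disjoint_iff_inter_eq_empty.1 (pairwiseDisjoint_cellsIn P A hC hC' hne) : C ∩ C' = ∅),
      eval_empty]
  rw [h1, h2, Nat.cast_sum, Finset.sum_div, ← Finset.sum_sub_distrib]
  exact Finset.abs_sum_le_sum_abs _ _

end SetHom

end

/-! ### Translates and approximate equivariance -/

theorem MeasurableGroupoid.translate_biUnion {X 𝒢 ι : Type*} [MeasurableSpace X]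
    [MeasurableSpace 𝒢] (G : MeasurableGroupoid X 𝒢) (U : Set 𝒢) (s : Finset ι) (g : ι → Set X) :
    G.translate U (⋃ i ∈ s, g i) = ⋃ i ∈ s, G.translate U (g i) := by
  ext x
  simp only [translate, Set.mem_image, Set.mem_ofPred_eq, Set.mem_iUnion, exists_prop]
  constructor
  · rintro ⟨a, ⟨ha, i, hi, hai⟩, rfl⟩
    exact ⟨i, hi, a, ⟨ha, hai⟩, rfl⟩
  · rintro ⟨i, hi, a, ⟨ha, hai⟩, rfl⟩
    exact ⟨a, ⟨ha, i, hi, hai⟩, rfl⟩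

theorem biUnion_symmDiff_biUnion_subset {X ι : Type*} (s : Finset ι) (a b : ι → Set X) :
    (⋃ i ∈ s, a i) ∆ (⋃ i ∈ s, b i) ⊆ ⋃ i ∈ s, a i ∆ b i := by
  intro x hx
  simp only [Set.mem_symmDiff, Set.mem_iUnion, exists_prop, not_exists, not_and] at hx ⊢
  rcases hx with ⟨⟨i, hi, hx⟩, h⟩ | ⟨⟨i, hi, hx⟩, h⟩
  · exact ⟨i, hi, Or.inl ⟨hx, h i hi⟩⟩
  · exact ⟨i, hi, Or.inr ⟨hx, h i hi⟩⟩

section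

variable {X 𝒢 Y ℋ : Type*} [MeasurableSpace X] [MeasurableSpace 𝒢] [MeasurableSpace Y]
  [MeasurableSpace ℋ] {G : MeasurableGroupoid X 𝒢} {H : MeasurableGroupoid Y ℋ}

theorem isBorelPartition_translatePartition (π : GroupoidMorphism G H)
    (hπ : π.IsClassBijectiveExtension) {P : Finpartition (Set.univ : Set X)}
    (hP : IsBorelPartition P) (F : Finset (PartialAut H)) :
    IsBorelPartition (translatePartition π P F) := by
  refine isBorelPartition_coarsestPartition _ ?_
  rintro _ ⟨f, -, A, hA, rfl⟩
  exact π.measurableSet_act hπ f (hP A hA)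

theorem mem_sigmaPartition_translatePartition (π : GroupoidMorphism G H)
    (hπ : π.IsClassBijectiveExtension) (P : Finpartition (Set.univ : Set X))
    {F : Finset (PartialAut H)} (hF : PartialAut.one H ∈ F) {A : Set X}
    (hA : A ∈ sigmaPartition P) : A ∈ sigmaPartition (translatePartition π P F) :=
  preimage_mem_sigmaAlg id (fun _ hC => mem_sigmaAlg_of_mem_parts π hπ P F hF hC) hA

theorem act_mem_sigmaPartition (π : GroupoidMorphism G H) {P : Finpartition (Set.univ : Set X)}
    {F : Finset (PartialAut H)} {f : PartialAut H} (hf : f ∈ F) {A : Set X}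
    (hA : A ∈ sigmaPartition P) : π.act f A ∈ sigmaPartition (translatePartition π P F) := by
  rw [← biUnion_cellsIn hA, GroupoidMorphism.act, G.translate_biUnion]
  exact SetHom.biUnion_mem _ _ fun C hC =>
    translate_mem_sigmaAlg π P F hf (mem_cellsIn.1 hC).1

/-- Elements of `goodHoms` send null sets to small sets. -/
theorem ncard_eval_div_lt {π : GroupoidMorphism G H} (hπ : π.IsClassBijectiveExtension)
    {μ : Measure X} [IsFiniteMeasure μ] {d : ℕ} {σ : SoficMap H d}
    {P : Finpartition (Set.univ : Set X)} (hP : IsBorelPartition P) {F : Finset (PartialAut H)}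
    {δ : ℝ} {φ : SetHom (sigmaPartition (translatePartition π P F)) d}
    (hφ : φ ∈ goodHoms π μ σ P F δ) {N : Set X}
    (hN : N ∈ sigmaPartition (translatePartition π P F)) (h0 : μ N = 0) :
    ((φ.eval N).ncard : ℝ) / d < δ := by
  classical
  have h := SetHom.abs_ncard_eval_sub_le μ (isBorelPartition_translatePartition π hπ hP F) φ hN
  rw [Measure.real, h0, ENNReal.toReal_zero, sub_zero] at h
  refine (le_abs_self _).trans_lt (h.trans_lt (lt_of_le_of_lt ?_ hφ.2))
  exact Finset.sum_le_sum_of_subset_of_nonneg (fun C hC => (mem_cellsIn.1 hC).1)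
    fun C _ _ => abs_nonneg _

/-- `goodHoms` controls equivariance only on cells of `P`. Translation and φ both respect unions, so
the error on a union of cells is subadditive. -/
theorem ncard_translate_symmDiff_le (π : GroupoidMorphism G H) {d : ℕ} (τ : FinPartialAut d)
    {P : Finpartition (Set.univ : Set X)} {F : Finset (PartialAut H)}
    (hπ : π.IsClassBijectiveExtension) (hF : PartialAut.one H ∈ F) {f : PartialAut H}
    (hf : f ∈ F) (φ : SetHom (sigmaPartition (translatePartition π P F)) d) {A : Set X}
    (hA : A ∈ sigmaPartition P) :
    (((fullGroupoid d).translate τ.carrier (φ.eval A)) ∆ (φ.eval (π.act f A))).ncard ≤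
      ∑ B ∈ cellsIn P A,
        (((fullGroupoid d).translate τ.carrier (φ.eval B)) ∆ (φ.eval (π.act f B))).ncard := by
  have h1 : (fullGroupoid d).translate τ.carrier (φ.eval A) =
      ⋃ B ∈ cellsIn P A, (fullGroupoid d).translate τ.carrier (φ.eval B) := by
    conv_lhs => rw [← biUnion_cellsIn hA]
    rw [φ.eval_biUnion _ _ fun B hB => mem_sigmaAlg_of_mem_parts π hπ P F hF (mem_cellsIn.1 hB).1,
      MeasurableGroupoid.translate_biUnion]
  have h2 : φ.eval (π.act f A) = ⋃ B ∈ cellsIn P A, φ.eval (π.act f B) := by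
    conv_lhs => rw [← biUnion_cellsIn hA, GroupoidMorphism.act, G.translate_biUnion]
    exact φ.eval_biUnion _ _ fun B hB => translate_mem_sigmaAlg π P F hf (mem_cellsIn.1 hB).1
  rw [h1, h2]
  exact (Set.ncard_le_ncard (biUnion_symmDiff_biUnion_subset _ _ _) (Set.toFinite _)).trans
    (Finset.set_ncard_biUnion_le _ _)

end

/-! ### Transport of approximate homomorphisms along `T` -/

section

variable {X₁ 𝒢₁ Y₁ ℋ₁ X₂ 𝒢₂ Y₂ ℋ₂ : Type*} [MeasurableSpace X₁] [MeasurableSpace 𝒢₁]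
  [MeasurableSpace Y₁] [MeasurableSpace ℋ₁] [MeasurableSpace X₂] [MeasurableSpace 𝒢₂]
  [MeasurableSpace Y₂] [MeasurableSpace ℋ₂]
  {G₁ : MeasurableGroupoid X₁ 𝒢₁} {H₁ : MeasurableGroupoid Y₁ ℋ₁}
  {G₂ : MeasurableGroupoid X₂ 𝒢₂} {H₂ : MeasurableGroupoid Y₂ ℋ₂}
  {π₁ : GroupoidMorphism G₁ H₁} {π₂ : GroupoidMorphism G₂ H₂}
  {μ₁ : Measure X₁} {μ₂ : Measure X₂} {T : X₁ → X₂} {t : PartialAut H₂ → PartialAut H₁}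
  {P₁ Q₁ : Finpartition (Set.univ : Set X₁)} {P₂ Q₂ : Finpartition (Set.univ : Set X₂)}
  {F₁ : Finset (PartialAut H₁)} {F₂ : Finset (PartialAut H₂)} {δ₁ δ₂ : ℝ} {d : ℕ}
  {σ₁ : SoficMap H₁ d} {σ₂ : SoficMap H₂ d}

theorem preimage_mem_sigmaPartition_translatePartition (hπ₁ : π₁.IsClassBijectiveExtension)
    (hF₁ : PartialAut.one H₁ ∈ F₁)
    (hP : ∀ A ∈ (translatePartition π₂ P₂ F₂).parts, T ⁻¹' A ∈ sigmaPartition P₁) (A : Set X₂)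
    (hA : A ∈ sigmaPartition (translatePartition π₂ P₂ F₂)) :
    T ⁻¹' A ∈ sigmaPartition (translatePartition π₁ P₁ F₁) :=
  preimage_mem_sigmaAlg T
    (fun C hC => mem_sigmaPartition_translatePartition π₁ hπ₁ P₁ hF₁ (hP C hC)) hA

theorem pullback_mem_goodHoms [IsFiniteMeasure μ₁] (hπ₁ : π₁.IsClassBijectiveExtension)
    (hπ₂ : π₂.IsClassBijectiveExtension) (hT : MeasurePreserving T μ₁ μ₂)
    (hP₁ : IsBorelPartition P₁) (hP₂ : IsBorelPartition P₂)
    (hF₁ : PartialAut.one H₁ ∈ F₁) (hF₂ : PartialAut.one H₂ ∈ F₂) (ht : ∀ f ∈ F₂, t f ∈ F₁)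
    (hσ : ∀ f ∈ F₂, σ₂ f = σ₁ (t f))
    (hact : ∀ f ∈ F₂, ∀ A ∈ P₂.parts, μ₁ (π₁.act (t f) (T ⁻¹' A) ∆ (T ⁻¹' π₂.act f A)) = 0)
    (hP : ∀ A ∈ (translatePartition π₂ P₂ F₂).parts, T ⁻¹' A ∈ sigmaPartition P₁)
    (hδ₁ : 0 < δ₁) (hδ : (P₂.parts.card + 1) * δ₁ ≤ δ₂)
    {φ : SetHom (sigmaPartition (translatePartition π₁ P₁ F₁)) d}
    (hφ : φ ∈ goodHoms π₁ μ₁ σ₁ P₁ F₁ δ₁) :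
    φ.pullback T (preimage_mem_sigmaPartition_translatePartition hπ₁ hF₁ hP) ∈
      goodHoms π₂ μ₂ σ₂ P₂ F₂ δ₂ := by
  set h𝒮 := preimage_mem_sigmaPartition_translatePartition (T := T) hπ₁ hF₁ hP
  -- Membership in Σ(P₁), not merely in Σ(P₁^F₁), is required: these preimages are acted on once
  -- more, and only translates of sets in Σ(P₁) are known to lie in Σ(P₁^F₁).
  have hPP : ∀ A ∈ P₂.parts, T ⁻¹' A ∈ sigmaPartition P₁ := fun A hA =>
    preimage_mem_sigmaAlg T hP (mem_sigmaAlg_of_mem_parts π₂ hπ₂ P₂ F₂ hF₂ hA)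
  refine ⟨fun f hf => ?_, ?_⟩
  · have key : ∀ A ∈ P₂.parts,
        ((((fullGroupoid d).translate (σ₂ f).carrier ((φ.pullback T h𝒮).eval A)) ∆
          ((φ.pullback T h𝒮).eval (π₂.act f A))).ncard : ℝ) / d ≤
        ∑ B ∈ cellsIn P₁ (T ⁻¹' A),
          ((((fullGroupoid d).translate (σ₁ (t f)).carrier (φ.eval B)) ∆
            (φ.eval (π₁.act (t f) B))).ncard : ℝ) / d + δ₁ := by
      intro A hA
      have hact' := act_mem_sigmaPartition π₁ (ht f hf) (hPP A hA)
      have hact₂ := h𝒮 _ (translate_mem_sigmaAlg π₂ P₂ F₂ hf hA)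
      -- Acting before or after `T⁻¹` gives sets with null difference, which φ sends to density
      -- below `δ₁`. This costs one `δ₁` for each cell of `P₂`.
      have hN := ncard_eval_div_lt hπ₁ hP₁ hφ (SetHom.symmDiff_mem hact' hact₂) (hact f hf A hA)
      rw [φ.eval_symmDiff hact' hact₂] at hN
      rw [SetHom.eval_pullback _ _ _ (mem_sigmaAlg_of_mem_parts π₂ hπ₂ P₂ F₂ hF₂ hA),
        SetHom.eval_pullback _ _ _ (translate_mem_sigmaAlg π₂ P₂ F₂ hf hA), hσ f hf]
      have h1 := ncard_translate_symmDiff_le π₁ (σ₁ (t f)) hπ₁ hF₁ (ht f hf) φ (hPP A hA)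
      have h2 : (((fullGroupoid d).translate (σ₁ (t f)).carrier (φ.eval (T ⁻¹' A))) ∆
          φ.eval (T ⁻¹' π₂.act f A)).ncard ≤ _ :=
        (Set.ncard_le_ncard (symmDiff_triangle _ (φ.eval (π₁.act (t f) (T ⁻¹' A))) _)
          (Set.toFinite _)).trans (Set.ncard_union_le _ _)
      have h3 := h2.trans (Nat.add_le_add_right h1 _)
      have h4 : ((((fullGroupoid d).translate (σ₁ (t f)).carrier (φ.eval (T ⁻¹' A))) ∆
          φ.eval (T ⁻¹' π₂.act f A)).ncard : ℝ) / d ≤ _ :=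
        div_le_div_of_nonneg_right (Nat.cast_le.2 h3) d.cast_nonneg
      rw [Nat.cast_add, add_div, Nat.cast_sum, Finset.sum_div] at h4
      linarith
    -- Distinct cells have disjoint preimages, so the remaining errors sum to at most the total
    -- error of φ, below one further `δ₁`. This explains the factor `P₂.parts.card + 1`.
    have hsum := sum_sum_cellsIn_le P₂.parts (fun A => T ⁻¹' A)
      (fun A hA B hB hAB => (P₂.disjoint hA hB hAB).preimage T) P₁
      (fun B => ((((fullGroupoid d).translate (σ₁ (t f)).carrier (φ.eval B)) ∆
        (φ.eval (π₁.act (t f) B))).ncard : ℝ) / d) (fun B => by positivity)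
    refine (Finset.sum_le_sum key).trans_lt ?_
    rw [Finset.sum_add_distrib, Finset.sum_const, nsmul_eq_mul]
    have := hφ.1 (t f) (ht f hf)
    linarith
  · have key : ∀ A ∈ (translatePartition π₂ P₂ F₂).parts,
        |(((φ.pullback T h𝒮).eval A).ncard : ℝ) / d - μ₂.real A| ≤
        ∑ C ∈ cellsIn (translatePartition π₁ P₁ F₁) (T ⁻¹' A),
          |((φ.eval C).ncard : ℝ) / d - μ₁.real C| := by
      intro A hA
      have hA' : A ∈ sigmaPartition (translatePartition π₂ P₂ F₂) := subset_sigmaAlg hA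
      have hm := isBorelPartition_translatePartition π₂ hπ₂ hP₂ F₂ A hA
      rw [SetHom.eval_pullback _ _ _ hA', ← hT.measureReal_preimage
        hm.nullMeasurableSet]
      exact SetHom.abs_ncard_eval_sub_le μ₁ (isBorelPartition_translatePartition π₁ hπ₁ hP₁ F₁) φ
        (h𝒮 A hA')
    refine (Finset.sum_le_sum key).trans_lt ((sum_sum_cellsIn_le _ (fun A => T ⁻¹' A)
      (fun A hA B hB hAB => ((translatePartition π₂ P₂ F₂).disjoint hA hB hAB).preimage T) _
      (fun C => |((φ.eval C).ncard : ℝ) / d - μ₁.real C|) (fun C => abs_nonneg _)).trans_lt ?_)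
    have h1 : δ₁ ≤ δ₂ := hδ.trans' <| by
      have : (0 : ℝ) ≤ P₂.parts.card := Nat.cast_nonneg _
      nlinarith
    exact hφ.2.trans_le h1

/-- The number of small subsets of `{1, …, d}`. -/
def smallSubsetCount (d : ℕ) (δ : ℝ) : ℕ := Nat.card {E : Set (Fin d) // (E.ncard : ℝ) / d < δ}

/-- The set φ(C) is recovered from φ(T⁻¹T'⁻¹C), which the pullback sees because T'⁻¹C ∈ Σ(Q₂), and
from the symmetric difference of the two, which is a small set. -/
theorem homCount_le [IsFiniteMeasure μ₁] (hπ₁ : π₁.IsClassBijectiveExtension)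
    (hπ₂ : π₂.IsClassBijectiveExtension) (hT : MeasurePreserving T μ₁ μ₂)
    (hP₁ : IsBorelPartition P₁) (hP₂ : IsBorelPartition P₂)
    (hF₁ : PartialAut.one H₁ ∈ F₁) (hF₂ : PartialAut.one H₂ ∈ F₂) (ht : ∀ f ∈ F₂, t f ∈ F₁)
    (hσ : ∀ f ∈ F₂, σ₂ f = σ₁ (t f))
    (hact : ∀ f ∈ F₂, ∀ A ∈ P₂.parts, μ₁ (π₁.act (t f) (T ⁻¹' A) ∆ (T ⁻¹' π₂.act f A)) = 0)
    (hP : ∀ A ∈ (translatePartition π₂ P₂ F₂).parts, T ⁻¹' A ∈ sigmaPartition P₁)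
    (hδ₁ : 0 < δ₁) (hδ : (P₂.parts.card + 1) * δ₁ ≤ δ₂)
    (hPQ₁ : P₁ ≤ Q₁) (hPQ₂ : P₂ ≤ Q₂) {T' : X₂ → X₁}
    (hQ : ∀ C ∈ Q₁.parts, T' ⁻¹' C ∈ sigmaPartition Q₂)
    (hT' : ∀ C ∈ Q₁.parts, μ₁ (C ∆ (T ⁻¹' (T' ⁻¹' C))) = 0) :
    homCount π₁ μ₁ σ₁ Q₁ P₁ F₁ δ₁ ≤
      homCount π₂ μ₂ σ₂ Q₂ P₂ F₂ δ₂ * smallSubsetCount d δ₁ ^ Q₁.parts.card := by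
  set h𝒮 := preimage_mem_sigmaPartition_translatePartition (T := T) hπ₁ hF₁ hP
  have hQ₂ : ∀ A ∈ sigmaPartition Q₂, A ∈ sigmaPartition (translatePartition π₂ P₂ F₂) :=
    fun A hA => mem_sigmaPartition_translatePartition π₂ hπ₂ P₂ hF₂
      (mem_sigmaPartition_of_le hPQ₂ hA)
  have hQ₁ : ∀ C ∈ Q₁.parts, C ∈ sigmaPartition (translatePartition π₁ P₁ F₁) := fun C hC =>
    mem_sigmaPartition_translatePartition π₁ hπ₁ P₁ hF₁
      (mem_sigmaPartition_of_le hPQ₁ (subset_sigmaAlg hC))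
  have hQT : ∀ C ∈ Q₁.parts, T ⁻¹' (T' ⁻¹' C) ∈ sigmaPartition (translatePartition π₁ P₁ F₁) :=
    fun C hC => h𝒮 _ (hQ₂ _ (hQ C hC))
  rw [homCount, ← Nat.card_coe_set_eq, homCount, ← Nat.card_coe_set_eq]
  have hcard : smallSubsetCount d δ₁ ^ Q₁.parts.card =
      Nat.card (Q₁.parts → {E : Set (Fin d) // (E.ncard : ℝ) / d < δ₁}) := by
    rw [Nat.card_fun, smallSubsetCount, Nat.card_eq_fintype_card (α := Q₁.parts),
      Fintype.card_coe]
  rw [hcard, ← Nat.card_prod]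
  choose φ hφ hφQ using fun ψ : {ψ : SetHom (sigmaPartition Q₁) d |
    ∃ φ ∈ goodHoms π₁ μ₁ σ₁ P₁ F₁ δ₁, ∀ A : sigmaPartition Q₁,
      ∃ hA : (A : Set X₁) ∈ sigmaPartition (translatePartition π₁ P₁ F₁), ψ A = φ ⟨A, hA⟩} => ψ.2
  -- With an extension `φ ψ` of each ψ chosen, ψ is encoded by the pullback of `φ ψ` restricted to
  -- Σ(Q₂) together with one small set for each cell of `Q₁`.
  refine Nat.card_le_card_of_injective (fun ψ => (
    ⟨(φ ψ).pullback T fun A hA => h𝒮 A (hQ₂ A hA), (φ ψ).pullback T h𝒮,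
      pullback_mem_goodHoms hπ₁ hπ₂ hT hP₁ hP₂ hF₁ hF₂ ht hσ hact hP hδ₁ hδ (hφ ψ),
      fun A => ⟨hQ₂ A A.2, rfl⟩⟩,
    fun C => ⟨(φ ψ).eval (C ∆ (T ⁻¹' (T' ⁻¹' C))), ncard_eval_div_lt hπ₁ hP₁ (hφ ψ)
      (SetHom.symmDiff_mem (hQ₁ C C.2) (hQT C C.2)) (hT' C C.2)⟩)) ?_
  intro ψ ψ' h
  simp only [Prod.mk.injEq, Subtype.mk.injEq] at h
  obtain ⟨h1, h2⟩ := h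
  refine Subtype.ext (SetHom.ext_parts fun C hC => ?_)
  have h3 : ∀ ψ, ψ.1.eval C = (φ ψ).eval C := fun ψ => by
    obtain ⟨hA, h⟩ := hφQ ψ ⟨C, subset_sigmaAlg hC⟩
    rw [SetHom.eval_of_mem _ hA, ← h]
    exact SetHom.eval_of_mem _ (subset_sigmaAlg hC)
  have h4 : (φ ψ).eval (T ⁻¹' (T' ⁻¹' C)) = (φ ψ').eval (T ⁻¹' (T' ⁻¹' C)) := by
    have h := congrArg (fun φ => SetHom.eval φ (T' ⁻¹' C)) h1
    simpa only [SetHom.eval_pullback _ _ _ (hQ C hC)] using h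
  have h5 := Subtype.mk.inj (congrFun h2 ⟨C, hC⟩)
  rw [SetHom.eval_symmDiff _ (hQ₁ C hC) (hQT C hC),
    SetHom.eval_symmDiff _ (hQ₁ C hC) (hQT C hC), h4] at h5
  rw [h3, h3]
  exact symmDiff_left_injective _ h5

end

/-! ### Counting small subsets -/

/-- A Chernoff bound: give E the weight exp(-s|E|). The total weight is (1 + exp(-s))^d ≤ exp(εd/2),
while each small set has weight at least exp(-εd/2). -/
theorem smallSubsetCount_le {ε : ℝ} (hε : 0 < ε) :
    ∃ δ > 0, ∀ δ' ≤ δ, ∀ d : ℕ, 0 < d → (smallSubsetCount d δ' : ℝ) ≤ Real.exp (ε * d) := by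
  obtain ⟨s, hs, hsε⟩ : ∃ s : ℝ, 0 < s ∧ Real.exp (-s) ≤ ε / 2 := by
    refine ⟨max 1 (-Real.log (ε / 2)), by positivity, ?_⟩
    rw [← Real.le_log_iff_exp_le (by positivity)]
    linarith [le_max_right 1 (-Real.log (ε / 2))]
  -- This value makes s|E| at most (ε/2)d whenever |E|/d is below the threshold.
  refine ⟨ε / (2 * s), by positivity, fun δ' hδ' d hd => ?_⟩
  classical
  have hd' : (0 : ℝ) < d := by exact_mod_cast hd
  let S : Finset (Finset (Fin d)) := Finset.univ.filter fun E => (E.card : ℝ) / d < δ'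
  have hS : smallSubsetCount d δ' = S.card := by
    rw [smallSubsetCount, ← Fintype.card_coe S, ← Nat.card_eq_fintype_card]
    refine Nat.card_congr ((Equiv.subtypeEquiv Fintype.finsetEquivSet fun E => ?_).symm)
    simp [S, Set.ncard_coe_finset]
  have h1 : ∑ E : Finset (Fin d), Real.exp (-s) ^ E.card = (Real.exp (-s) + 1) ^ d := by
    simpa using Fin.sum_pow_mul_eq_add_pow (n := d) (Real.exp (-s)) 1
  have h2 : (S.card : ℝ) * Real.exp (-(ε / 2 * d)) ≤ ∑ E ∈ S, Real.exp (-s) ^ E.card := by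
    rw [← nsmul_eq_mul]
    refine Finset.card_nsmul_le_sum _ _ _ fun E hE => ?_
    have hE' : (E.card : ℝ) / d < ε / (2 * s) := (Finset.mem_filter.1 hE).2.trans_le hδ'
    rw [← Real.exp_nat_mul, Real.exp_le_exp]
    rw [div_lt_div_iff₀ hd' (by positivity)] at hE'
    nlinarith
  have h3 : (Real.exp (-s) + 1) ^ d ≤ Real.exp (ε / 2 * d) := by
    rw [mul_comm, Real.exp_nat_mul]
    exact pow_le_pow_left₀ (by positivity)
      ((Real.add_one_le_exp _).trans (Real.exp_le_exp.2 hsε)) _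
  have h4 : (S.card : ℝ) * Real.exp (-(ε / 2 * d)) ≤ Real.exp (ε / 2 * d) :=
    h2.trans ((Finset.sum_le_sum_of_subset_of_nonneg (Finset.subset_univ S)
      fun _ _ _ => by positivity).trans (h1.trans_le h3))
  rw [hS, show ε * d = ε / 2 * d + ε / 2 * d by ring, Real.exp_add]
  rwa [Real.exp_neg, ← div_eq_mul_inv, div_le_iff₀ (Real.exp_pos _)] at h4

/-! ### Measurability of the counts and additive errors in limits -/

instance (d : ℕ) : Finite (FinPartialAut d) :=
  Finite.of_injective PartialAut.carrier fun _ _ => PartialAut.ext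

instance (d : ℕ) : DiscreteMeasurableSpace (FinPartialAut d) := ⟨fun _ => trivial⟩

section

variable {X 𝒢 Y ℋ : Type*} [MeasurableSpace X] [MeasurableSpace 𝒢] [MeasurableSpace Y]
  [MeasurableSpace ℋ] {G : MeasurableGroupoid X 𝒢} {H : MeasurableGroupoid Y ℋ}

theorem homCount_congr (π : GroupoidMorphism G H) (μ : Measure X) {d : ℕ} {σ σ' : SoficMap H d}
    (Q P : Finpartition (Set.univ : Set X)) {F : Finset (PartialAut H)} (δ : ℝ)
    (h : ∀ f ∈ F, σ f = σ' f) : homCount π μ σ Q P F δ = homCount π μ σ' Q P F δ := by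
  have : goodHoms π μ σ P F δ = goodHoms π μ σ' P F δ := by
    ext φ
    refine and_congr_left fun _ => forall₂_congr fun f hf => ?_
    rw [h f hf]
  rw [homCount, homCount, this]

/-- The count depends on σ only through its values on the finite set `F`, that is, on a point of a
finite discrete space. -/
theorem measurable_homCount (π : GroupoidMorphism G H) (μ : Measure X) (d : ℕ)
    (Q P : Finpartition (Set.univ : Set X)) (F : Finset (PartialAut H)) (δ : ℝ) :
    Measurable fun σ : SoficMap H d => (homCount π μ σ Q P F δ : ℝ) := by
  classical
  -- The value off `F` is arbitrary, since `homCount` never reads it.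
  let e : (F → FinPartialAut d) → SoficMap H d := fun τ f =>
    if hf : f ∈ F then τ ⟨f, hf⟩ else PartialAut.one _
  have h : (fun σ : SoficMap H d => (homCount π μ σ Q P F δ : ℝ)) =
      (fun τ => (homCount π μ (e τ) Q P F δ : ℝ)) ∘ fun σ (f : F) => σ f := by
    funext σ
    simp only [Function.comp_apply, Nat.cast_inj]
    exact homCount_congr π μ Q P δ fun f hf => by simp [e, hf]
  rw [h]
  exact (measurable_of_finite _).comp (measurable_pi_lambda _ fun f => measurable_pi_apply _)

end

theorem le_of_forall_pos_le_add_coe {a b : EReal} (h : ∀ ε : ℝ, 0 < ε → a ≤ b + (ε : EReal)) :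
    a ≤ b := by
  refine EReal.le_of_forall_lt_iff_le.1 fun z hz => ?_
  induction b with
  | bot => exact (h 1 one_pos).trans (by simp)
  | top => simp at hz
  | coe b =>
    refine (h (z - b) (sub_pos.2 (EReal.coe_lt_coe_iff.1 hz))).trans ?_
    rw [← EReal.coe_add, add_sub_cancel]

/-- Every bias sees only tails of J, and a finite error cannot produce ∞ - ∞, so it passes through
all three kinds of limit. -/
theorem Bias.lim_le_lim_add {J : Type*} [Preorder J] [IsDirectedOrder J] [Nonempty J]
    (β : Bias J) {Φ Ψ : J → EReal} {ε : ℝ} (h : ∀ᶠ j in atTop, Φ j ≤ Ψ j + (ε : EReal)) :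
    β.lim Φ ≤ β.lim Ψ + (ε : EReal) := by
  cases β with
  | minus =>
    have h2 := EReal.liminf_add_le (f := (atTop : Filter J)) (u := fun _ => (ε : EReal)) (v := Ψ)
      (Or.inl (by simp)) (Or.inl (by simp))
    rw [limsup_const, add_comm (ε : EReal)] at h2
    refine (liminf_le_liminf h).trans (le_trans (le_of_eq ?_) h2)
    exact congrArg (liminf · atTop) (funext fun j => add_comm _ _)
  | plus =>
    have h2 := EReal.limsup_add_le (f := (atTop : Filter J)) (u := Ψ) (v := fun _ => (ε : EReal))
      (Or.inr (by simp)) (Or.inr (by simp))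
    rw [limsup_const] at h2
    exact (limsup_le_limsup h).trans h2
  | ultra U hU =>
    have hle : (U : Filter J) ≤ atTop := le_iInf fun j => le_principal_iff.2 (hU j)
    have hΨ : Tendsto (fun j => Ψ j + (ε : EReal)) U (𝓝 ((Bias.ultra U hU).lim Ψ + ε)) :=
      (EReal.continuousAt_add (p := ((Bias.ultra U hU).lim Ψ, (ε : EReal)))
        (Or.inr (by simp)) (Or.inr (by simp))).tendsto.comp
          ((Bias.tendsto_lim U hU Ψ).prodMk_nhds tendsto_const_nhds)
    exact le_of_tendsto_of_tendsto (Bias.tendsto_lim U hU Φ) hΨ (hle h)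

/-! ### Comparison of entropies -/

section

variable {X₁ 𝒢₁ Y₁ ℋ₁ X₂ 𝒢₂ Y₂ ℋ₂ : Type*} [MeasurableSpace X₁] [MeasurableSpace 𝒢₁]
  [MeasurableSpace Y₁] [MeasurableSpace ℋ₁] [MeasurableSpace X₂] [MeasurableSpace 𝒢₂]
  [MeasurableSpace Y₂] [MeasurableSpace ℋ₂]
  {G₁ : MeasurableGroupoid X₁ 𝒢₁} {H₁ : MeasurableGroupoid Y₁ ℋ₁}
  {G₂ : MeasurableGroupoid X₂ 𝒢₂} {H₂ : MeasurableGroupoid Y₂ ℋ₂}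
  {π₁ : GroupoidMorphism G₁ H₁} {π₂ : GroupoidMorphism G₂ H₂}
  {μ₁ : Measure X₁} {μ₂ : Measure X₂} {T : X₁ → X₂} {T' : X₂ → X₁}
  {t : PartialAut H₂ → PartialAut H₁}

/-- Comparison of the entropies of two extensions which are isomorphic up to null sets. -/
theorem entropy_le_of_ae_iso [IsFiniteMeasure μ₁] (hπ₁ : π₁.IsClassBijectiveExtension)
    (hπ₂ : π₂.IsClassBijectiveExtension) (hT : MeasurePreserving T μ₁ μ₂)
    (hT'm : Measurable T') (hT' : ∀ᵐ x ∂μ₁, T' (T x) = x)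
    (hact : ∀ f, ∀ A, μ₁ (π₁.act (t f) (T ⁻¹' A) ∆ (T ⁻¹' π₂.act f A)) = 0)
    {J : Type*} [Preorder J] [IsDirectedOrder J] [Nonempty J] {d : J → ℕ}
    (hd : Tendsto d atTop atTop) {Ω : J → Type*} [∀ j, MeasurableSpace (Ω j)]
    {P : ∀ j, Measure (Ω j)} {g₁ : ∀ j, Ω j → SoficMap H₁ (d j)}
    {g₂ : ∀ j, Ω j → SoficMap H₂ (d j)} (hg₁ : ∀ j, Measurable (g₁ j))
    (hg₂ : ∀ j, Measurable (g₂ j)) (ht : ∀ f j, ∀ᵐ ω ∂(P j), g₂ j ω f = g₁ j ω (t f))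
    (p : ℝ≥0∞) (β : Bias J) :
    entropy π₁ μ₁ d (fun j => (P j).map (g₁ j)) p β ≤
      entropy π₂ μ₂ d (fun j => (P j).map (g₂ j)) p β := by
  classical
  refine iSup₂_le fun Q₁ hQ₁ => ?_
  have hSfin : (Set.preimage T' '' (Q₁.parts : Set (Set X₁))).Finite :=
    Q₁.parts.finite_toSet.image _
  -- Preimages under `T'` carry `Q₁` to the other space; the preimage under `T` of such a set
  -- differs from the original cell by a null set.
  refine le_iSup₂_of_le (coarsestPartition _ hSfin)
    (isBorelPartition_coarsestPartition hSfin ?_) ?_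
  · rintro _ ⟨C, hC, rfl⟩
    exact hT'm (hQ₁ C hC)
  refine le_iInf₂ fun P₂ hP₂ => le_iInf fun hPQ₂ => le_iInf₂ fun F₂ hF₂ => le_iInf₂ fun δ₂ hδ₂ =>
    le_of_forall_pos_le_add_coe fun ε hε => ?_
  -- The count of small sets enters with exponent `Q₁.parts.card`, hence the division of ε; the
  -- added 1 avoids dividing by zero.
  obtain ⟨δ, hδ, hcount⟩ := smallSubsetCount_le (ε := ε / (Q₁.parts.card + 1)) (by positivity)
  set δ₁ := min δ (δ₂ / (P₂.parts.card + 1))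
  have hδ₁ : 0 < δ₁ := lt_min hδ (by positivity)
  have hδ₁₂ : (P₂.parts.card + 1) * δ₁ ≤ δ₂ := by
    rw [mul_comm, ← le_div_iff₀ (by positivity)]
    exact min_le_right _ _
  have hP₂F := isBorelPartition_translatePartition π₂ hπ₂ hP₂ F₂
  -- `P₁` must refine `Q₁` and resolve all preimages of cells of P₂^F₂, so that homomorphisms can be
  -- pulled back.
  set S : Set (Set X₁) :=
    Q₁.parts ∪ Set.preimage T '' ((translatePartition π₂ P₂ F₂).parts : Set (Set X₂))
  have hS : S.Finite := Q₁.parts.finite_toSet.union ((Finset.finite_toSet _).image _)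
  have hP₁ : IsBorelPartition (coarsestPartition S hS) := by
    refine isBorelPartition_coarsestPartition hS ?_
    rintro A (hA | ⟨C, hC, rfl⟩)
    · exact hQ₁ A hA
    · exact hT.measurable (hP₂F C hC)
  have hPQ₁ : coarsestPartition S hS ≤ Q₁ := coarsestPartition_le hS fun A hA => Or.inl hA
  obtain ⟨F₁, hF₁, htF⟩ : ∃ F₁ : Finset (PartialAut H₁),
      PartialAut.one H₁ ∈ F₁ ∧ ∀ f ∈ F₂, t f ∈ F₁ :=
    ⟨insert (PartialAut.one H₁) (F₂.image t), Finset.mem_insert_self _ _,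
      fun f hf => Finset.mem_insert_of_mem (Finset.mem_image_of_mem t hf)⟩
  refine (iInf₂_le_of_le _ hP₁ (iInf_le_of_le hPQ₁ (iInf₂_le_of_le F₁ hF₁
    (iInf₂_le_of_le δ₁ hδ₁ le_rfl)))).trans (β.lim_le_lim_add ?_)
  filter_upwards [hd.eventually_gt_atTop 0] with j hj
  have hj' : (0 : ℝ) < d j := by exact_mod_cast hj
  -- Both norms are moved to the common space `Ω j`, where the two random maps can be compared
  -- pointwise.
  rw [eLpNorm_map_measure (measurable_homCount ..).aestronglyMeasurable (hg₁ j).aemeasurable,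
    eLpNorm_map_measure (measurable_homCount ..).aestronglyMeasurable (hg₂ j).aemeasurable]
  set h₁ : Ω j → ℝ := (fun σ => (homCount π₁ μ₁ σ Q₁ _ _ δ₁ : ℝ)) ∘ g₁ j
  set h₂ : Ω j → ℝ := (fun σ => (homCount π₂ μ₂ σ _ P₂ F₂ δ₂ : ℝ)) ∘ g₂ j
  have hae : ∀ᵐ ω ∂(P j), ∀ f ∈ F₂, g₂ j ω f = g₁ j ω (t f) :=
    (Finset.eventually_all F₂).2 fun f _ => ht f j
  have hle : ∀ᵐ ω ∂(P j), ‖h₁ ω‖ ≤ ‖(Real.exp (ε * d j) • h₂) ω‖ := by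
    filter_upwards [hae] with ω hω
    have h0 : 0 ≤ h₂ ω := Nat.cast_nonneg _
    have h0' : 0 ≤ h₁ ω := Nat.cast_nonneg _
    rw [Pi.smul_apply, smul_eq_mul, Real.norm_of_nonneg h0',
      Real.norm_of_nonneg (by positivity), mul_comm]
    have hcnt := homCount_le (σ₁ := g₁ j ω) (σ₂ := g₂ j ω) (T' := T') hπ₁ hπ₂ hT hP₁ hP₂ hF₁ hF₂
      htF hω
      (fun f _ A _ => hact f A)
      (fun A hA => mem_sigmaPartition_coarsestPartition hS (Or.inr ⟨A, hA, rfl⟩)) hδ₁ hδ₁₂ hPQ₁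
      hPQ₂ (fun C hC => mem_sigmaPartition_coarsestPartition hSfin ⟨C, hC, rfl⟩)
      (fun C _ => ?_)
    · have hcnt' : h₁ ω ≤ _ := Nat.cast_le.2 hcnt
      refine hcnt'.trans ?_
      rw [Nat.cast_mul, Nat.cast_pow]
      refine mul_le_mul_of_nonneg_left ?_ h0
      refine (pow_le_pow_left₀ (Nat.cast_nonneg _) (hcount δ₁ (min_le_left _ _) _ hj) _).trans ?_
      rw [← Real.exp_nat_mul, Real.exp_le_exp, ← mul_assoc]
      refine mul_le_mul_of_nonneg_right ?_ hj'.le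
      rw [mul_div_assoc', div_le_iff₀ (by positivity)]
      nlinarith
    · rw [measure_symmDiff_eq_zero_iff]
      filter_upwards [hT'] with x hx
      change (x ∈ C) = (T' (T x) ∈ C)
      rw [hx]
  have hnorm := eLpNorm_mono_ae (p := p) hle
  rw [eLpNorm_const_smul, Real.enorm_of_nonneg (Real.exp_pos _).le] at hnorm
  have hlog := ENNReal.log_le_log hnorm
  rw [ENNReal.log_mul_add, ENNReal.log_ofReal_of_pos (Real.exp_pos _), Real.log_exp,
    add_comm] at hlog
  have hdE : (0 : EReal) ≤ ((d j : ℝ) : EReal) := EReal.coe_nonneg.2 hj'.le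
  -- The factor exp(ε d) has become the summand ε d after the logarithm, and contributes exactly ε
  -- after division by d.
  refine (EReal.div_le_div_right_of_nonneg hdE hlog).trans ?_
  rw [EReal.add_div_of_nonneg_right hdE, ← EReal.coe_div, mul_div_cancel_right₀ _ hj'.ne']

end

/-! ### Two conull restrictions of one morphism -/

section Transfer

variable {X : Type*}

open Classical in
/-- The map `A → B` which is the identity on `A ∩ B` and has the constant value `b` elsewhere. -/
def transfer (A : Set X) {B : Set X} (b : B) (x : A) : B :=
  ⟨if (x : X) ∈ B then x else b, by split_ifs with h; exacts [h, b.2]⟩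

theorem transfer_of_mem (A : Set X) {B : Set X} (b : B) {x : A} (h : (x : X) ∈ B) :
    transfer A b x = ⟨x, h⟩ := Subtype.ext (if_pos h)

variable [MeasurableSpace X]

theorem measurable_transfer (A : Set X) {B : Set X} (hB : MeasurableSet B) (b : B) :
    Measurable (transfer A b) :=
  (Measurable.ite (measurable_subtype_coe hB) measurable_subtype_coe
    measurable_const).subtype_mk

theorem measurePreserving_transfer {μ : Measure X} {A B : Set X} (hA : MeasurableSet A)
    (hB : MeasurableSet B) (hμA : μ Aᶜ = 0) (hμB : μ Bᶜ = 0) (b : B) :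
    MeasurePreserving (transfer A b) (μ.comap Subtype.val) (μ.comap Subtype.val) := by
  refine ⟨measurable_transfer A hB b, Measure.ext fun S hS => ?_⟩
  rw [Measure.map_apply (measurable_transfer A hB b) hS, comap_subtype_coe_apply hA,
    comap_subtype_coe_apply hB]
  refine measure_congr ?_
  filter_upwards [mem_ae_iff.2 hμA, mem_ae_iff.2 hμB] with x hxA hxB
  refine propext ?_
  change x ∈ _ '' _ ↔ x ∈ _ '' _
  simp only [Set.mem_image, Set.mem_preimage, Subtype.exists, exists_and_right, exists_eq_right]
  constructor
  · rintro ⟨_, h⟩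
    rw [transfer_of_mem A b (x := ⟨x, hxA⟩) hxB] at h
    exact ⟨hxB, h⟩
  · rintro ⟨_, h⟩
    refine ⟨hxA, ?_⟩
    rwa [transfer_of_mem A b (x := ⟨x, hxA⟩) hxB]

end Transfer

section

variable {X 𝒢 Y ℋ : Type*} [MeasurableSpace X] [MeasurableSpace 𝒢] [MeasurableSpace Y]
  [MeasurableSpace ℋ] {G : MeasurableGroupoid X 𝒢} {H : MeasurableGroupoid Y ℋ}

theorem BorelSubgroupoid.IsConull.measure_image_r_compl {K : BorelSubgroupoid G} {μ : Measure X}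
    (hK : K.IsConull μ) (hG : G.IsDiscretePMP μ) : μ (G.r '' K.carrierᶜ) = 0 :=
  measure_image_r_eq_zero hG K.measurableSet.compl hK

theorem BorelSubgroupoid.IsConull.measure_obj_compl {K : BorelSubgroupoid G} {μ : Measure X}
    (hK : K.IsConull μ) (hG : G.IsDiscretePMP μ) : μ K.objᶜ = 0 :=
  measure_mono_null (t := G.r '' K.carrierᶜ) (fun x hx => ⟨G.unit x, hx, G.r_unit x⟩) (hK.measure_image_r_compl hG)

/-- The part of an element of `⟦L⟧` that lies in `M`, as an element of `⟦M⟧`. -/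
def BorelSubgroupoid.interPartialAut (M : BorelSubgroupoid H) {L : BorelSubgroupoid H}
    (f : PartialAut L.toGroupoid) : PartialAut M.toGroupoid where
  carrier := Subtype.val ⁻¹' (inclusion f).carrier
  measurableSet := measurable_subtype_coe (inclusion f).measurableSet
  injOn_s _ ha _ hb h := Subtype.ext ((inclusion f).injOn_s ha hb (congrArg Subtype.val h))
  injOn_r _ ha _ hb h := Subtype.ext ((inclusion f).injOn_r ha hb (congrArg Subtype.val h))

/-- Only arrows outside `M` are lost. This is the input to the `null` clause of a sofic
approximation. -/
theorem BorelSubgroupoid.measS_symmDiff_interPartialAut {L M : BorelSubgroupoid H} {ν : Measure Y}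
    (hM : M.IsConull ν) (f : PartialAut L.toGroupoid) :
    H.measS ν ((inclusion f).carrier ∆ (inclusion (M.interPartialAut f)).carrier) = 0 := by
  refine le_antisymm ((measS_mono ν ?_).trans hM.le) zero_le
  rintro g (⟨hg, hg'⟩ | ⟨⟨g, hg, rfl⟩, hg'⟩)
  · exact fun hM => hg' ⟨⟨g, hM⟩, hg, rfl⟩
  · exact absurd hg hg'

variable {π : GroupoidMorphism G H} {μ : Measure X} {ν : Measure Y}

theorem ClassBijectiveRestriction.measure_act_symmDiff_act (R₁ R₂ : ClassBijectiveRestriction π μ ν)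
    (hG : G.IsDiscretePMP μ) (x₀ : R₂.K.obj) (f : PartialAut R₂.L.toGroupoid)
    (A : Set R₂.K.obj) :
    R₁.K.restrictMeasure μ
      ((π.restrict R₁.K R₁.L R₁.mapsTo).act (R₁.L.interPartialAut f)
        (transfer R₁.K.obj x₀ ⁻¹' A) ∆
      (transfer R₁.K.obj x₀ ⁻¹' (π.restrict R₂.K R₂.L R₂.mapsTo).act f A)) = 0 := by
  rw [BorelSubgroupoid.restrictMeasure, comap_subtype_coe_apply R₁.K.measurableSet_obj]
  -- The exceptional null set depends on neither `f` nor `A`, so no measurability of `A` is needed.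
  refine measure_mono_null ?_ (measure_union_null (R₁.conull_K.measure_image_r_compl hG)
    (R₂.conull_K.measure_image_r_compl hG))
  rintro _ ⟨x, hx, rfl⟩
  by_contra hbad
  simp only [Set.mem_union, Set.mem_image, Set.mem_compl_iff, not_or, not_exists, not_and] at hbad
  have mem₁ : ∀ g, G.r g = x → g ∈ R₁.K.carrier := fun g hg =>
    by_contra fun h => hbad.1 g h hg
  have mem₂ : ∀ g, G.r g = x → g ∈ R₂.K.carrier := fun g hg =>
    by_contra fun h => hbad.2 g h hg
  have hx₂ : (x : X) ∈ R₂.K.obj := mem₂ _ (G.r_unit _)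
  suffices h : x ∈ (π.restrict R₁.K R₁.L R₁.mapsTo).act (R₁.L.interPartialAut f)
      (transfer R₁.K.obj x₀ ⁻¹' A) ↔
      transfer R₁.K.obj x₀ x ∈ (π.restrict R₂.K R₂.L R₂.mapsTo).act f A by
    rcases hx with ⟨h1, h2⟩ | ⟨h1, h2⟩
    · exact h2 (h.1 h1)
    · exact h2 (h.2 h1)
  rw [transfer_of_mem _ _ hx₂]
  constructor
  · rintro ⟨g, ⟨⟨k, hk, hkg⟩, hA⟩, hr⟩
    have hrx : G.r g = x := congrArg Subtype.val hr
    have hg₂ := mem₂ g hrx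
    refine ⟨⟨g, hg₂⟩, ⟨?_, ?_⟩, Subtype.ext hrx⟩
    · obtain rfl : k = ⟨π.mor g, R₂.mapsTo hg₂⟩ := Subtype.ext hkg
      exact hk
    -- The whole arrow lies in both subgroupoids, so its source does too and is fixed by `transfer`;
    -- knowing this for x alone would not suffice.
    · rw [Set.mem_preimage, transfer_of_mem _ _ (R₂.K.s_mem hg₂)] at hA
      exact hA
  · rintro ⟨g, ⟨hf, hA⟩, hr⟩
    have hrx : G.r g = x := congrArg Subtype.val hr
    have hg₁ := mem₁ g hrx
    refine ⟨⟨g, hg₁⟩, ⟨⟨_, hf, rfl⟩, ?_⟩, Subtype.ext hrx⟩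
    rw [Set.mem_preimage, transfer_of_mem _ _ (R₂.K.s_mem g.2)]
    exact hA

theorem ClassBijectiveRestriction.entropy_le_entropy (hπ : π.IsPMP μ ν) {J : Type*} [Preorder J]
    [IsDirectedOrder J] [Nonempty J] {d : J → ℕ} {ℙ : ∀ j, Measure (SoficMap H (d j))}
    (hℙ : IsSoficApproximation H ν d ℙ) (p : ℝ≥0∞) (β : Bias J)
    (R₁ R₂ : ClassBijectiveRestriction π μ ν) : R₁.entropy d ℙ p β ≤ R₂.entropy d ℙ p β := by
  have := hπ.source.isProbabilityMeasure
  have hμ := fun R : ClassBijectiveRestriction π μ ν => R.conull_K.measure_obj_compl hπ.source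
  -- A conull set for a probability measure is nonempty, which supplies the default values of
  -- `transfer`.
  have hne : ∀ R : ClassBijectiveRestriction π μ ν, Nonempty R.K.obj := fun R => by
    by_contra h
    have h1 := hμ R
    rw [Set.not_nonempty_iff_eq_empty'.1 h, Set.compl_empty, measure_univ] at h1
    exact one_ne_zero h1
  obtain ⟨x₁⟩ := hne R₁
  obtain ⟨x₂⟩ := hne R₂
  have : IsFiniteMeasure (R₁.K.restrictMeasure μ) := ⟨by
    rw [BorelSubgroupoid.restrictMeasure, comap_subtype_coe_apply R₁.K.measurableSet_obj]
    exact measure_lt_top _ _⟩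
  have hae : ∀ᵐ x : R₁.K.obj ∂(R₁.K.restrictMeasure μ), (x : X) ∈ R₂.K.obj := by
    rw [ae_iff, BorelSubgroupoid.restrictMeasure,
      comap_subtype_coe_apply R₁.K.measurableSet_obj]
    refine measure_mono_null ?_ (hμ R₂)
    rintro _ ⟨x, hx, rfl⟩
    exact hx
  have hmeas : ∀ (R : ClassBijectiveRestriction π μ ν) (j : J), Measurable
      fun (σ : SoficMap H (d j)) f => σ (BorelSubgroupoid.inclusion (K := R.L) f) := fun R j =>
    measurable_pi_lambda _ fun f => measurable_pi_apply _
  -- The common probability space is `ℙ j` itself: the two laws come from restricting one random σ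
  -- to ⟦L₁⟧ and to ⟦L₂⟧.
  refine entropy_le_of_ae_iso R₁.classBijective R₂.classBijective
    (measurePreserving_transfer R₁.K.measurableSet_obj R₂.K.measurableSet_obj (hμ R₁) (hμ R₂) x₂)
    (T' := transfer R₂.K.obj x₁) (measurable_transfer _ R₁.K.measurableSet_obj x₁) ?_
    (R₁.measure_act_symmDiff_act R₂ hπ.source x₂) hℙ.tendsto_d (hmeas R₁) (hmeas R₂)
    (fun f j => hℙ.null _ _ (BorelSubgroupoid.measS_symmDiff_interPartialAut R₁.conull_L f) j) p β
  filter_upwards [hae] with x hx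
  rw [transfer_of_mem _ _ hx]
  exact transfer_of_mem _ _ x.2

end

end SoficEntropy

end

theorem theorem11p1 {X 𝒢 Y ℋ : Type*} [MeasurableSpace X] [MeasurableSpace 𝒢]
    [MeasurableSpace Y] [MeasurableSpace ℋ]
    (G : SoficEntropy.MeasurableGroupoid X 𝒢) (H : SoficEntropy.MeasurableGroupoid Y ℋ)
    (μ : Measure X) (ν : Measure Y)
    (π : SoficEntropy.GroupoidMorphism G H) (hπ : π.IsPMP μ ν)
    {J : Type*} [Preorder J] [IsDirectedOrder J] [Nonempty J] (d : J → ℕ)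
    (ℙ : ∀ j, Measure (SoficEntropy.SoficMap H (d j)))
    (hℙ : SoficEntropy.IsSoficApproximation H ν d ℙ)
    (p : ℝ≥0∞) (hp : 1 ≤ p) (β : SoficEntropy.Bias J)
    (R₁ R₂ : SoficEntropy.ClassBijectiveRestriction π μ ν) :
    R₁.entropy d ℙ p β = R₂.entropy d ℙ p β ∧
      ∃! h : EReal, ∀ R : SoficEntropy.ClassBijectiveRestriction π μ ν,
        R.entropy d ℙ p β = h := by
  have key : ∀ R R' : SoficEntropy.ClassBijectiveRestriction π μ ν,
      R.entropy d ℙ p β = R'.entropy d ℙ p β := fun R R' =>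
    le_antisymm (R.entropy_le_entropy hπ hℙ p β R') (R'.entropy_le_entropy hπ hℙ p β R)
  exact ⟨key R₁ R₂, R₁.entropy d ℙ p β, fun R => key R R₁, fun h hh => (hh R₁).symm⟩
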